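/- Throughout $m\ge 1$ is an integer. The first Heisenberg group $\mathbb H^1$ is $\mathbb R^3$ with points $(x,y,t)$ and group law $(x,y,t)(x',y',t')=(x+x',\,y+y',\,t+t'+2(yx'-xy'))$. Its horizontal vector fields are $X=\partial_x+2y\,\partial_t$ and $Y=\partial_y-2x\,\partial_t$. A curve $\gamma:\mathbb R\to\mathbb H^1$ is horizontal if it is absolutely continuous on every compact interval and $\gamma'(s)\in\operatorname{span}\{X(\gamma(s)),Y(\gamma(s))\}$ for almost every $s$. Let $K\subset\mathbb R$ be compact. A jet of order $m$ on $K$ is a family $F=(F^k)_{k=0}^m$ of continuous functions $F^k:K\to\mathbb R$; write $F=F^0$. For $a\in K$ put $T_aF(x)=\sum_{k=0}^m\frac{F^k(a)}{k!}(x-a)^k$. The jet $F$ is a Whitney field of class $C^m$ on $K$ if for every $0\le k\le m$ $$F^k(b)-\sum_{\ell=0}^{m-k}\frac{F^{k+\ell}(a)}{\ell!}(b-a)^\ell=o(|a-b|^{m-k})\quad\text{as }|a-b|\to0,\ a,b\in K,$$ uniformly in $a,b$. For $k\ge1$ let $\mathcal P^k$ be the polynomial obtained by differentiating $2(f'g-g'f)$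 $k-1$ times with the Leibniz rule: $$\mathcal P^k(x_0,y_0,\dots,x_k,y_k)=2\sum_{i=0}^{k-1}\binom{k-1}{i}\left(x_{i+1}y_{k-1-i}-y_{i+1}x_{k-1-i}\right).$$ For jets $F,G,H$ of order $m$ on $K$ and $a,b\in K$ with $a<b$ define $$A(a,b)=H(b)-H(a)-2\int_a^b\big((T_aF)'\,T_aG-(T_aG)'\,T_aF\big)+2F(a)\big(G(b)-T_aG(b)\big)-2G(a)\big(F(b)-T_aF(b)\big),$$ $$V(a,b)=(b-a)^{2m}+(b-a)^m\int_a^b\big(|(T_aF)'|+|(T_aG)'|\big).$$ **Theorem.** Let $K\subset\mathbb R$ be compact and let $F,G,H$ be jets of order $m\ge 1$ on $K$. There is a $C^m$ horizontal curve $(f,g,h):\mathbb R\to\mathbb H^1$ with $D^kf(x)=F^k(x)$, $D^kg(x)=G^k(x)$ and $D^kh(x)=H^k(x)$ for all $x\in K$ and $0\le k\le m$ if and only if 1. $F$, $G$ and $H$ are Whitney fields of class $C^m$ on $K$; 2. $H^k(t)=\mathcal P^k\big(F^0(t),G^0(t),F^1(t),G^1(t),\dots,F^k(t),G^k(t)\big)$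 for all $1\le k\le m$ and $t\in K$; 3. $A(a,b)/V(a,b)\to0$ uniformly as $(b-a)\searrow0$ with $a,b\in K$, i.e. for every $\varepsilon>0$ there is $\delta>0$ such that $|A(a,b)/V(a,b)|<\varepsilon$ for all $a,b\in K$ with $0<b-a<\delta$. -/

import Mathlib

noncomputable section

namespace HeisWhitney

/-- The underlying space `ℝ³` of the first Heisenberg group `ℍ¹`, with points `(x, y, t)`. The group
law is `(x, y, t) (x', y', t') = (x + x', y + y', t + t' + 2 (y x' - x y'))`; the left invariant
vector fields that span its horizontal layer are `fieldX` and `fieldY` below. -/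
abbrev Heis : Type := ℝ × ℝ × ℝ

/-- The left invariant vector field `X = ∂_x + 2 y ∂_t`. -/
def fieldX (p : Heis) : Heis := (1, 0, 2 * p.2.1)

/-- The left invariant vector field `Y = ∂_y - 2 x ∂_t`. -/
def fieldY (p : Heis) : Heis := (0, 1, -2 * p.1)

/-- `v` is horizontal at `p`: a linear combination of `X(p)` and `Y(p)`. -/
def IsHorizontalAt (p v : Heis) : Prop :=
  v ∈ Submodule.span ℝ ({fieldX p, fieldY p} : Set Heis)

/-- A curve `γ : ℝ → ℍ¹` is horizontal if it is absolutely continuous (on every compact interval)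
and `γ'(t)` is horizontal at `γ(t)` for almost every `t`. -/
def IsHorizontalCurve (γ : ℝ → Heis) : Prop :=
  (∀ a b : ℝ, AbsolutelyContinuousOnInterval γ a b) ∧
    ∀ᵐ t : ℝ, IsHorizontalAt (γ t) (deriv γ t)

/-- `F = (F⁰, …, Fᵐ)` is a jet of order `m` on `K`: each `Fᵏ`, `0 ≤ k ≤ m`, is continuous on `K`.
Only the values `F k x` with `k ≤ m` and `x ∈ K` are meaningful. -/
def IsJet (m : ℕ) (K : Set ℝ) (F : ℕ → ℝ → ℝ) : Prop :=
  ∀ k ≤ m, ContinuousOn (F k) K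

/-- The Taylor polynomial `T_a^m F (x) = ∑_{k=0}^m F^k(a) / k! (x - a)^k`. -/
def taylorPoly (m : ℕ) (F : ℕ → ℝ → ℝ) (a : ℝ) : Polynomial ℝ :=
  ∑ k ∈ Finset.range (m + 1),
    Polynomial.C (F k a / (k.factorial : ℝ)) * (Polynomial.X - Polynomial.C a) ^ k

/-- The remainder `(R_a^m F)^k (x) = F^k(x) - ∑_{ℓ=0}^{m-k} F^{k+ℓ}(a) / ℓ! (x - a)^ℓ`, `k ≤ m`. -/
def remainder (m : ℕ) (F : ℕ → ℝ → ℝ) (a : ℝ) (k : ℕ) (x : ℝ) : ℝ :=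
  F k x - ∑ l ∈ Finset.range (m - k + 1), F (k + l) a / (l.factorial : ℝ) * (x - a) ^ l

/-- The jet `F` is a Whitney field of class `C^m` on `K`: for every `0 ≤ k ≤ m`,
`(R_a^m F)^k (b) = o(|a - b|^{m-k})` as `|a - b| → 0` with `a, b ∈ K`. -/
def IsWhitneyField (m : ℕ) (K : Set ℝ) (F : ℕ → ℝ → ℝ) : Prop :=
  ∀ k ≤ m, ∀ ε : ℝ, 0 < ε → ∃ δ : ℝ, 0 < δ ∧ ∀ a ∈ K, ∀ b ∈ K, |a - b| < δ →
    |remainder m F a k b| ≤ ε * |a - b| ^ (m - k)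

/-- The polynomial `𝒫^k`, `k ≥ 1`, in the variables `x_j = X (inl j)` and `y_j = X (inr j)` that
stand for `D^j f` and `D^j g`. It is the `(k-1)`-st derivative of `2 (f' g - g' f)` expanded by
the Leibniz rule:
`2 ∑_{i=0}^{k-1} (k-1 choose i) (x_{i+1} y_{k-1-i} - y_{i+1} x_{k-1-i})`. -/
def horizPoly (k : ℕ) : MvPolynomial (ℕ ⊕ ℕ) ℝ :=
  MvPolynomial.C 2 * ∑ i ∈ Finset.range k, MvPolynomial.C ((k - 1).choose i : ℝ) *
    (MvPolynomial.X (Sum.inl (i + 1)) * MvPolynomial.X (Sum.inr (k - 1 - i)) -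
      MvPolynomial.X (Sum.inr (i + 1)) * MvPolynomial.X (Sum.inl (k - 1 - i)))

/-- The area discrepancy `A(a, b)`. -/
def areaDiscrepancy (m : ℕ) (F G H : ℕ → ℝ → ℝ) (a b : ℝ) : ℝ :=
  H 0 b - H 0 a
    - 2 * (∫ x in a..b,
        ((taylorPoly m F a).derivative.eval x * (taylorPoly m G a).eval x
          - (taylorPoly m G a).derivative.eval x * (taylorPoly m F a).eval x))
    + 2 * F 0 a * (G 0 b - (taylorPoly m G a).eval b)
    - 2 * G 0 a * (F 0 b - (taylorPoly m F a).eval b)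

/-- The velocity `V(a, b)`; it is positive when `a < b`. -/
def velocity (m : ℕ) (F G : ℕ → ℝ → ℝ) (a b : ℝ) : ℝ :=
  (b - a) ^ (2 * m) + (b - a) ^ m *
    (∫ x in a..b,
      (|(taylorPoly m F a).derivative.eval x| + |(taylorPoly m G a).derivative.eval x|))

/-- The triple `(F, G, H)` extends to the `C^m` horizontal curve `(f, g, h) : ℝ → ℍ¹`. -/
def ExtendsTo (m : ℕ) (K : Set ℝ) (F G H : ℕ → ℝ → ℝ) (f g h : ℝ → ℝ) : Prop :=
  ContDiff ℝ m (fun t => ((f t, g t, h t) : Heis)) ∧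
  IsHorizontalCurve (fun t => ((f t, g t, h t) : Heis)) ∧
  ∀ k ≤ m, ∀ x ∈ K,
    iteratedDeriv k f x = F k x ∧ iteratedDeriv k g x = G k x ∧ iteratedDeriv k h x = H k x

end HeisWhitney

end

namespace HeisWhitney

open Polynomial Set Filter Topology

/-! A horizontal curve is determined by its projection `(f, g)` and one height, because `h' = 2 (f'
g - g' f)`. Extending the triple therefore means extending `F` and `G` so that across every bounded
component `(a, b)` of the complement of `K` twice the area `∫ (f' g - g' f)` equals `H(b) - H(a)`.

Necessity: condition 2 is the Leibniz rule. For condition 3, expand the area around the Taylor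
polynomials at `a` (`area_expand`). The boundary terms of an integration by parts are the correction
terms in `A`; what remains is `o(V)`, since the remainders are `o((b-a)^m)` and their derivatives
`o((b-a)^(m-1))` (`abs_areaDiscrepancy_le`).

Sufficiency: rescale a gap to `[0, 1]` and put `l = (b-a)^m`. The Taylor polynomial plus a Hermite
correction of size `o(l)` has the right jets at both ends, and by condition 3 its area misses the
target by `o(l² + l I)`, where `I` is the integrated speed of the Taylor curve. The area is repaired
by a perturbation flat at both ends with `m`-th derivative `o(l)`, which becomes `o(1)` after
scaling back. If `I ≤ l`, the deficit is `o(l²)`, and a fixed loop, whose area is quadratic in its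
amplitude, needs amplitude `o(l)` (`exists_flat_quadratic`). If `I ≥ l`, the deficit is `o(l I)`,
and pushing the curve along its rotated velocity changes the area at first order by an amount
comparable to `I` times the push, because velocities are polynomials of degree `< m` and norms on
that space are equivalent (`exists_flat_linear`). `exists_flat_small` joins the two regimes.

Gluing: the `m`-th derivatives on the gaps patch with `F^m` to a continuous function, which is
integrated `m` times. A function on `K` with zero derivative along `K` and equal values at the ends
of each gap is constant (`eq_of_hasDerivWithinAt_zero`); this identifies the jets of the
antiderivative, and also the lifted height, with the prescribed data (`sufficiency`). -/

/-! ### Swept area under a perturbation of the curve -/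

/-- Integrating `r' q - s' p` by parts turns the cross terms into `2 (p' s - q' r)` plus the
boundary value `r(b) q(b) - s(b) p(b)`. Replacing `q(b), p(b)` by `q(a), p(a)` costs only `r(b) ∫ q'
- s(b) ∫ p'`, so every remaining term carries a factor `p'`, `q'` or is quadratic in the
perturbation. -/
lemma area_expand {a b M N : ℝ} (hab : a ≤ b) {p q r s p' q' r' s' : ℝ → ℝ}
    (hp : ∀ x, HasDerivAt p (p' x) x) (hq : ∀ x, HasDerivAt q (q' x) x)
    (hr : ∀ x, HasDerivAt r (r' x) x) (hs : ∀ x, HasDerivAt s (s' x) x)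
    (cp : Continuous p') (cq : Continuous q') (cr : Continuous r') (cs : Continuous s')
    (ra : r a = 0) (sa : s a = 0)
    (br : ∀ x ∈ Icc a b, |r x| ≤ M) (bs : ∀ x ∈ Icc a b, |s x| ≤ M)
    (br' : ∀ x ∈ Icc a b, |r' x| ≤ N) (bs' : ∀ x ∈ Icc a b, |s' x| ≤ N) :
    |(∫ x in a..b, ((p' x + r' x) * (q x + s x) - (q' x + s' x) * (p x + r x)))
        - (∫ x in a..b, (p' x * q x - q' x * p x)) - r b * q a + s b * p a|
      ≤ 3 * M * (∫ x in a..b, (|p' x| + |q' x|)) + 2 * M * N * (b - a) := by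
  have dp : Continuous p := continuous_iff_continuousAt.2 fun x => (hp x).continuousAt
  have dq : Continuous q := continuous_iff_continuousAt.2 fun x => (hq x).continuousAt
  have dr : Continuous r := continuous_iff_continuousAt.2 fun x => (hr x).continuousAt
  have ds : Continuous s := continuous_iff_continuousAt.2 fun x => (hs x).continuousAt
  set e : ℝ → ℝ := fun x => r b * q' x - s b * p' x + 2 * (p' x * s x - q' x * r x)
    + (r' x * s x - s' x * r x) with he
  have ce : Continuous e := by fun_prop
  have ftc : ∫ x in a..b, (((p' x + r' x) * (q x + s x) - (q' x + s' x) * (p x + r x))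
      - (p' x * q x - q' x * p x) - e x) = r b * q a - s b * p a := by
    rw [intervalIntegral.integral_eq_sub_of_hasDerivAt
      (f := fun x => r x * q x - s x * p x - r b * q x + s b * p x)]
    · simp only [ra, sa]; ring
    · intro x _
      refine ((((hr x).mul (hq x)).sub ((hs x).mul (hp x))).sub
        ((hq x).const_mul (r b))).add ((hp x).const_mul (s b)) |>.congr_deriv ?_
      simp only [he]; ring
    · apply Continuous.intervalIntegrable; fun_prop
  rw [intervalIntegral.integral_sub (by apply Continuous.intervalIntegrable; fun_prop)
    (ce.intervalIntegrable _ _),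
    intervalIntegral.integral_sub (by apply Continuous.intervalIntegrable; fun_prop)
      (by apply Continuous.intervalIntegrable; fun_prop)] at ftc
  have key : (∫ x in a..b, ((p' x + r' x) * (q x + s x) - (q' x + s' x) * (p x + r x)))
        - (∫ x in a..b, (p' x * q x - q' x * p x)) - r b * q a + s b * p a = ∫ x in a..b, e x := by
    linarith
  rw [key]
  calc |∫ x in a..b, e x| ≤ ∫ x in a..b, (3 * M * (|p' x| + |q' x|) + 2 * M * N) := by
        refine (intervalIntegral.abs_integral_le_integral_abs hab).trans ?_
        apply intervalIntegral.integral_mono_on hab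
        · exact ce.abs.intervalIntegrable _ _
        · apply Continuous.intervalIntegrable; fun_prop
        intro x hx
        have hb : b ∈ Icc a b := right_mem_Icc.2 hab
        have m1 : ∀ {u v c d : ℝ}, |u| ≤ c → |v| ≤ d → |u * v| ≤ c * d := by
          intro u v c d h1 h2
          rw [abs_mul]
          exact mul_le_mul h1 h2 (abs_nonneg _) ((abs_nonneg _).trans h1)
        have h1 := m1 (br b hb) (le_refl |q' x|)
        have h2 := m1 (bs b hb) (le_refl |p' x|)
        have h3 := m1 (le_refl |p' x|) (bs x hx)
        have h4 := m1 (le_refl |q' x|) (br x hx)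
        have h5 := m1 (br' x hx) (bs x hx)
        have h6 := m1 (bs' x hx) (br x hx)
        simp only [he]
        rw [abs_le] at *
        constructor <;> linarith [h1.1, h1.2, h2.1, h2.2, h3.1, h3.2, h4.1, h4.2, h5.1, h5.2,
          h6.1, h6.2]
    _ = _ := by
      rw [intervalIntegral.integral_add (by apply Continuous.intervalIntegrable; fun_prop)
        (by simp), intervalIntegral.integral_const_mul, intervalIntegral.integral_const, smul_eq_mul]
      ring

/-! ### Taylor polynomials, remainders and Whitney fields -/

lemma taylorPoly_iterate_derivative_eval {m k : ℕ} (hk : k ≤ m) (F : ℕ → ℝ → ℝ) (a x : ℝ) :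
    (derivative^[k] (taylorPoly m F a)).eval x
      = ∑ l ∈ Finset.range (m - k + 1), F (k + l) a / (l.factorial : ℝ) * (x - a) ^ l := by
  have e : m + 1 = k + (m - k + 1) := by omega
  rw [taylorPoly, iterate_derivative_sum, eval_finsetSum, e, Finset.sum_range_add,
    Finset.sum_eq_zero, zero_add]
  · refine Finset.sum_congr rfl fun l _ => ?_
    rw [iterate_derivative_C_mul, iterate_derivative_X_sub_pow]
    simp only [eval_mul, eval_C, nsmul_eq_mul, eval_natCast, eval_pow, eval_sub, eval_X]
    rw [Nat.add_sub_cancel_left]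
    have h := Nat.factorial_mul_descFactorial (Nat.le_add_right k l)
    rw [Nat.add_sub_cancel_left] at h
    have h' : ((k + l).factorial : ℝ) = l.factorial * (k + l).descFactorial k := by
      exact_mod_cast h.symm
    have h1 : (l.factorial : ℝ) ≠ 0 := by positivity
    have h2 : ((k + l).descFactorial k : ℝ) ≠ 0 := by
      have := Nat.factorial_ne_zero (k + l)
      rw [← h] at this
      exact_mod_cast right_ne_zero_of_mul this
    rw [h']; field_simp
  · intro l hl
    rw [Finset.mem_range] at hl
    rw [iterate_derivative_C_mul, iterate_derivative_X_sub_pow, Nat.descFactorial_of_lt hl]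
    simp

lemma remainder_eq {m k : ℕ} (hk : k ≤ m) (F : ℕ → ℝ → ℝ) (a x : ℝ) :
    remainder m F a k x = F k x - (derivative^[k] (taylorPoly m F a)).eval x := by
  rw [remainder, taylorPoly_iterate_derivative_eval hk]

lemma taylorPoly_iterate_derivative_eval_self {m k : ℕ} (hk : k ≤ m) (F : ℕ → ℝ → ℝ) (a : ℝ) :
    (derivative^[k] (taylorPoly m F a)).eval a = F k a := by
  rw [taylorPoly_iterate_derivative_eval hk, Finset.sum_range_succ']
  simp

lemma remainder_self {m k : ℕ} (hk : k ≤ m) (F : ℕ → ℝ → ℝ) (a : ℝ) :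
    remainder m F a k a = 0 := by
  rw [remainder_eq hk, taylorPoly_iterate_derivative_eval_self hk, sub_self]

lemma taylorPoly_iterate_derivative_top (m : ℕ) (F : ℕ → ℝ → ℝ) (a x : ℝ) :
    (derivative^[m] (taylorPoly m F a)).eval x = F m a := by
  rw [taylorPoly_iterate_derivative_eval le_rfl]
  simp

lemma hasDerivAt_iteratedDeriv {m k : ℕ} {f : ℝ → ℝ} (hf : ContDiff ℝ m f) (hk : k < m) (x : ℝ) :
    HasDerivAt (iteratedDeriv k f) (iteratedDeriv (k + 1) f x) x := by
  rw [iteratedDeriv_succ]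
  exact (hf.differentiable_iteratedDeriv k (by exact_mod_cast hk) x).hasDerivAt

lemma hasDerivAt_iterate_derivative (p : ℝ[X]) (k : ℕ) (x : ℝ) :
    HasDerivAt (fun x => (derivative^[k] p).eval x) ((derivative^[k + 1] p).eval x) x := by
  rw [Function.iterate_succ_apply']
  exact (derivative^[k] p).hasDerivAt x

lemma hasDerivAt_remainder {m k : ℕ} {f : ℝ → ℝ} (hf : ContDiff ℝ m f) (hk : k < m) (a x : ℝ) :
    HasDerivAt (remainder m (fun k => iteratedDeriv k f) a k)
      (remainder m (fun k => iteratedDeriv k f) a (k + 1) x) x := by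
  rw [remainder_eq hk]
  have := (hasDerivAt_iteratedDeriv hf hk x).sub
    (hasDerivAt_iterate_derivative (taylorPoly m (fun k => iteratedDeriv k f) a) k x)
  refine this.congr_of_eventuallyEq (Eventually.of_forall fun y => ?_)
  simp [remainder_eq hk.le]

/-- The jet of a `C^m` function is a Whitney field on every compact interval. -/
lemma isWhitneyField_of_contDiff {m : ℕ} {f : ℝ → ℝ} (hf : ContDiff ℝ m f) (c d : ℝ) :
    IsWhitneyField m (Icc c d) (fun k => iteratedDeriv k f) := by
  have huc : UniformContinuousOn (iteratedDeriv m f) (Icc c d) :=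
    isCompact_Icc.uniformContinuousOn_of_continuous
      (hf.continuous_iteratedDeriv m le_rfl).continuousOn
  rw [Metric.uniformContinuousOn_iff] at huc
  intro k hk ε hε
  obtain ⟨δ, hδ, H⟩ := huc ε hε
  refine ⟨δ, hδ, fun a ha b hb hab => ?_⟩
  -- Downward induction on the order `m - j`: the top remainder is an increment of the `m`-th
  -- derivative, and each application of the mean value inequality gains a factor `|a - x|`.
  have main : ∀ j ≤ m, ∀ x ∈ uIcc a b,
      |remainder m (fun k => iteratedDeriv k f) a (m - j) x| ≤ ε * |a - x| ^ j := by
    intro j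
    induction j with
    | zero =>
      intro _ x hx
      have hxc : x ∈ Icc c d := (ordConnected_Icc.uIcc_subset ha hb) hx
      have hxd : |x - a| < δ := (abs_sub_left_of_mem_uIcc hx).trans_lt (by rwa [abs_sub_comm])
      have := H x hxc a ha (by rwa [Real.dist_eq])
      rw [Nat.sub_zero, remainder_eq le_rfl, taylorPoly_iterate_derivative_top, pow_zero, mul_one]
      exact this.le
    | succ j ih =>
      intro hj x hx
      have e : m - (j + 1) + 1 = m - j := by omega
      have hsub : uIcc a x ⊆ uIcc a b := uIcc_subset_uIcc left_mem_uIcc hx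
      have := (convex_uIcc a x).norm_image_sub_le_of_norm_hasDerivWithin_le
        (f := remainder m (fun k => iteratedDeriv k f) a (m - (j + 1)))
        (C := ε * |a - x| ^ j)
        (fun y _ => (hasDerivAt_remainder hf (by omega) a y).hasDerivWithinAt)
        (fun y hy => by
          rw [e, Real.norm_eq_abs]
          refine (ih (by omega) y (hsub hy)).trans ?_
          have : |a - y| ≤ |a - x| := by
            rw [abs_sub_comm a y, abs_sub_comm a x]; exact abs_sub_left_of_mem_uIcc hy
          gcongr)
        left_mem_uIcc right_mem_uIcc
      rw [remainder_self (by omega), sub_zero, Real.norm_eq_abs, Real.norm_eq_abs,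
        abs_sub_comm x a] at this
      rw [pow_succ]; linarith
  have := main (m - k) (by omega) b right_mem_uIcc
  rwa [show m - (m - k) = k by omega] at this

lemma remainder_congr {m k : ℕ} (hk : k ≤ m) {F G : ℕ → ℝ → ℝ} {a b : ℝ}
    (ha : ∀ j ≤ m, F j a = G j a) (hb : ∀ j ≤ m, F j b = G j b) :
    remainder m F a k b = remainder m G a k b := by
  rw [remainder, remainder, hb k hk]
  congr 1
  refine Finset.sum_congr rfl fun l hl => ?_
  rw [Finset.mem_range] at hl
  rw [ha (k + l) (by omega)]

lemma taylorPoly_congr {m : ℕ} {F G : ℕ → ℝ → ℝ} {a : ℝ} (ha : ∀ j ≤ m, F j a = G j a) :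
    taylorPoly m F a = taylorPoly m G a := by
  refine Finset.sum_congr rfl fun l hl => ?_
  rw [Finset.mem_range] at hl
  rw [ha l (by omega)]

lemma exists_Icc_of_isCompact {K : Set ℝ} (hK : IsCompact K) : ∃ c d : ℝ, K ⊆ Icc c d := by
  obtain ⟨c, hc⟩ := hK.bddBelow
  obtain ⟨d, hd⟩ := hK.bddAbove
  exact ⟨c, d, fun x hx => ⟨hc hx, hd hx⟩⟩

lemma isWhitneyField_of_extension {m : ℕ} {K : Set ℝ} (hK : IsCompact K) {F : ℕ → ℝ → ℝ}
    {f : ℝ → ℝ} (hf : ContDiff ℝ m f) (hF : ∀ k ≤ m, ∀ x ∈ K, iteratedDeriv k f x = F k x) :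
    IsWhitneyField m K F := by
  obtain ⟨c, d, hcd⟩ := exists_Icc_of_isCompact hK
  intro k hk ε hε
  obtain ⟨δ, hδ, H⟩ := isWhitneyField_of_contDiff hf c d k hk ε hε
  refine ⟨δ, hδ, fun a ha b hb hab => ?_⟩
  rw [← remainder_congr (F := fun k => iteratedDeriv k f) hk (fun j hj => hF j hj a ha)
    (fun j hj => hF j hj b hb)]
  exact H a (hcd ha) b (hcd hb) hab

/-- A Whitney field is formally differentiable along `K`. -/
lemma IsWhitneyField.hasDerivWithinAt {m k : ℕ} {K : Set ℝ} {F : ℕ → ℝ → ℝ}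
    (hF : IsWhitneyField m K F) (hk : k < m) {x : ℝ} (hx : x ∈ K) :
    HasDerivWithinAt (F k) (F (k + 1) x) K x := by
  have h0 : HasDerivWithinAt (remainder m F x k) 0 K x := by
    rw [hasDerivWithinAt_iff_isLittleO, Asymptotics.isLittleO_iff]
    intro ε hε
    obtain ⟨δ, hδ, H⟩ := hF k hk.le ε hε
    have hd : ∀ᶠ y in 𝓝[K] x, |x - y| < min δ 1 := by
      refine nhdsWithin_le_nhds ?_
      filter_upwards [Metric.ball_mem_nhds x (lt_min hδ one_pos)] with y hy
      rwa [Metric.mem_ball, dist_comm, Real.dist_eq] at hy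
    filter_upwards [hd, self_mem_nhdsWithin] with y hy hyK
    rw [remainder_self hk.le, sub_zero, smul_zero, sub_zero, Real.norm_eq_abs, Real.norm_eq_abs,
      abs_sub_comm y x]
    refine (H x hx y hyK (hy.trans_le (min_le_left _ _))).trans ?_
    gcongr
    exact pow_le_of_le_one (abs_nonneg _) (hy.le.trans (min_le_right _ _)) (by omega)
  have h1 := hasDerivAt_iterate_derivative (taylorPoly m F x) k x
  rw [taylorPoly_iterate_derivative_eval_self (by omega)] at h1
  have := h0.add h1.hasDerivWithinAt
  rw [zero_add] at this
  refine this.congr (fun y _ => ?_) ?_ <;> simp [remainder_eq hk.le]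

/-! ### Horizontality as the contact equation -/

lemma isHorizontalAt_iff (x y t u v w : ℝ) :
    IsHorizontalAt (x, y, t) (u, v, w) ↔ w = 2 * (u * y - v * x) := by
  simp only [IsHorizontalAt, fieldX, fieldY, Submodule.mem_span_pair, Prod.smul_mk, Prod.mk_add_mk,
    Prod.mk.injEq, smul_eq_mul]
  constructor
  · rintro ⟨a, b, h1, h2, h3⟩
    rw [← h1, ← h2, ← h3]; ring
  · intro h
    exact ⟨u, v, by ring, by ring, by rw [h]; ring⟩

lemma contDiff_triple_iff {n : WithTop ℕ∞} {f g h : ℝ → ℝ} :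
    ContDiff ℝ n (fun t => ((f t, g t, h t) : Heis)) ↔
      ContDiff ℝ n f ∧ ContDiff ℝ n g ∧ ContDiff ℝ n h :=
  ⟨fun H => ⟨H.fst, H.snd.fst, H.snd.snd⟩, fun H => H.1.prodMk (H.2.1.prodMk H.2.2)⟩

lemma deriv_triple {f g h : ℝ → ℝ} (hf : Differentiable ℝ f) (hg : Differentiable ℝ g)
    (hh : Differentiable ℝ h) (t : ℝ) :
    deriv (fun t => ((f t, g t, h t) : Heis)) t = (deriv f t, deriv g t, deriv h t) :=
  ((hf t).hasDerivAt.prodMk ((hg t).hasDerivAt.prodMk (hh t).hasDerivAt)).deriv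

/-- For `C¹` curves horizontality is the pointwise contact equation. -/
lemma isHorizontalCurve_iff {f g h : ℝ → ℝ} (hf : ContDiff ℝ 1 f) (hg : ContDiff ℝ 1 g)
    (hh : ContDiff ℝ 1 h) :
    IsHorizontalCurve (fun t => ((f t, g t, h t) : Heis)) ↔
      ∀ t, deriv h t = 2 * (deriv f t * g t - deriv g t * f t) := by
  have df := hf.differentiable one_ne_zero
  have dg := hg.differentiable one_ne_zero
  have dh := hh.differentiable one_ne_zero
  have cf := hf.continuous_deriv le_rfl
  have cg := hg.continuous_deriv le_rfl
  have ch := hh.continuous_deriv le_rfl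
  have e : ∀ t, IsHorizontalAt ((f t, g t, h t) : Heis)
      (deriv (fun t => ((f t, g t, h t) : Heis)) t) ↔
        deriv h t = 2 * (deriv f t * g t - deriv g t * f t) := by
    intro t
    rw [deriv_triple df dg dh, isHorizontalAt_iff]
  constructor
  · rintro ⟨-, H⟩
    simp only [e] at H
    -- Both sides are continuous, so equality almost everywhere is equality everywhere.
    have := (Continuous.ae_eq_iff_eq MeasureTheory.volume (f := deriv h)
      (g := fun t => 2 * (deriv f t * g t - deriv g t * f t)) ch
      (by have := df.continuous; have := dg.continuous; fun_prop)).1 H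
    exact fun t => congrFun this t
  · intro H
    refine ⟨fun a b => ?_, Eventually.of_forall fun t => (e t).2 (H t)⟩
    obtain ⟨C, hC⟩ := (contDiff_triple_iff.2 ⟨hf, hg, hh⟩).contDiffOn.exists_lipschitzOnWith
      one_ne_zero (convex_uIcc a b) isCompact_uIcc
    exact hC.absolutelyContinuousOnInterval

lemma eval_horizPoly (k : ℕ) (u : ℕ ⊕ ℕ → ℝ) :
    MvPolynomial.eval u (horizPoly k) = 2 * ∑ i ∈ Finset.range k, ((k - 1).choose i : ℝ) *
      (u (Sum.inl (i + 1)) * u (Sum.inr (k - 1 - i))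
        - u (Sum.inr (i + 1)) * u (Sum.inl (k - 1 - i))) := by
  simp [horizPoly]

lemma eval_horizPoly_congr {k m : ℕ} (hk : k ≤ m) {F G F' G' : ℕ → ℝ}
    (hF : ∀ j ≤ m, F j = F' j) (hG : ∀ j ≤ m, G j = G' j) :
    MvPolynomial.eval (Sum.elim F G) (horizPoly k)
      = MvPolynomial.eval (Sum.elim F' G') (horizPoly k) := by
  rw [eval_horizPoly, eval_horizPoly]
  congr 1
  refine Finset.sum_congr rfl fun i hi => ?_
  rw [Finset.mem_range] at hi
  simp only [Sum.elim_inl, Sum.elim_inr]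
  rw [hF (i + 1) (by omega), hF (k - 1 - i) (by omega), hG (i + 1) (by omega),
    hG (k - 1 - i) (by omega)]

lemma iteratedDeriv_of_horizontal {m k : ℕ} {f g h : ℝ → ℝ} (hf : ContDiff ℝ m f)
    (hg : ContDiff ℝ m g) (hh : ∀ t, deriv h t = 2 * (deriv f t * g t - deriv g t * f t))
    (hk : 1 ≤ k) (hkm : k ≤ m) (t : ℝ) :
    iteratedDeriv k h t = MvPolynomial.eval
      (Sum.elim (fun j => iteratedDeriv j f t) (fun j => iteratedDeriv j g t)) (horizPoly k) := by
  obtain ⟨n, rfl⟩ : ∃ n, k = n + 1 := ⟨k - 1, by omega⟩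
  have cf : ContDiff ℝ (n + 1 : ℕ) f := hf.of_le (by exact_mod_cast hkm)
  have cg : ContDiff ℝ (n + 1 : ℕ) g := hg.of_le (by exact_mod_cast hkm)
  have cf' : ContDiff ℝ n (deriv f) := (contDiff_succ_iff_deriv.1 (by exact_mod_cast cf)).2.2
  have cg' : ContDiff ℝ n (deriv g) := (contDiff_succ_iff_deriv.1 (by exact_mod_cast cg)).2.2
  have cf0 : ContDiff ℝ n f := cf.of_le (by exact_mod_cast n.le_succ)
  have cg0 : ContDiff ℝ n g := cg.of_le (by exact_mod_cast n.le_succ)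
  have e : deriv h = fun t => 2 * (deriv f * g - deriv g * f) t := by
    ext t; simp [hh t]
  rw [iteratedDeriv_succ', e, iteratedDeriv_const_mul_field,
    iteratedDeriv_sub (f := deriv f * g) (g := deriv g * f)
      (cf'.mul cg0).contDiffAt (cg'.mul cf0).contDiffAt,
    iteratedDeriv_mul cf'.contDiffAt cg0.contDiffAt,
    iteratedDeriv_mul cg'.contDiffAt cf0.contDiffAt, eval_horizPoly, ← Finset.sum_sub_distrib]
  congr 1
  refine Finset.sum_congr rfl fun i _ => ?_
  simp only [Sum.elim_inl, Sum.elim_inr, Nat.add_sub_cancel, iteratedDeriv_succ']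
  ring

/-! ### Necessity of the three conditions -/

lemma velocity_pos {m : ℕ} (F G : ℕ → ℝ → ℝ) {a b : ℝ} (hab : a < b) :
    0 < velocity m F G a b := by
  have h : 0 < b - a := sub_pos.2 hab
  have : 0 ≤ ∫ x in a..b, (|(taylorPoly m F a).derivative.eval x|
      + |(taylorPoly m G a).derivative.eval x|) :=
    intervalIntegral.integral_nonneg hab.le fun x _ => by positivity
  rw [velocity]; positivity

/-- `area_expand` is applied to the Taylor polynomials and their remainders, with `M = ε (b-a)^m`
and `N = ε (b-a)^(m-1)`. After doubling, the error has coefficients `6 ε` and `4 ε²` on the two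
terms of the velocity, which `10 ε` dominates as `ε ≤ 1`. -/
lemma abs_areaDiscrepancy_le {m : ℕ} (hm : 1 ≤ m) {f g h : ℝ → ℝ} (hf : ContDiff ℝ m f)
    (hg : ContDiff ℝ m g) (hh : ContDiff ℝ m h)
    (hor : ∀ t, deriv h t = 2 * (deriv f t * g t - deriv g t * f t)) (c d : ℝ)
    {ε : ℝ} (hε : 0 < ε) (hε1 : ε ≤ 1) :
    ∃ δ : ℝ, 0 < δ ∧ ∀ a ∈ Icc c d, ∀ b ∈ Icc c d, a < b → b - a < δ →
      |areaDiscrepancy m (fun k => iteratedDeriv k f) (fun k => iteratedDeriv k g)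
        (fun k => iteratedDeriv k h) a b|
        ≤ 10 * ε * velocity m (fun k => iteratedDeriv k f) (fun k => iteratedDeriv k g) a b := by
  have C1 : ∀ {u : ℝ → ℝ}, ContDiff ℝ m u → ContDiff ℝ 1 u := fun hu =>
    hu.of_le (by exact_mod_cast hm)
  have Wh : ∀ {u : ℝ → ℝ}, ContDiff ℝ m u → ∃ δ : ℝ, 0 < δ ∧ ∀ a ∈ Icc c d, ∀ b ∈ Icc c d,
      |a - b| < δ →
      |u b - (taylorPoly m (fun k => iteratedDeriv k u) a).eval b| ≤ ε * |a - b| ^ m ∧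
      |deriv u b - (taylorPoly m (fun k => iteratedDeriv k u) a).derivative.eval b|
        ≤ ε * |a - b| ^ (m - 1) := by
    intro u hu
    obtain ⟨δ0, h0, H0⟩ := isWhitneyField_of_contDiff hu c d 0 (Nat.zero_le _) ε hε
    obtain ⟨δ1, h1, H1⟩ := isWhitneyField_of_contDiff hu c d 1 hm ε hε
    refine ⟨min δ0 δ1, lt_min h0 h1, fun a ha b hb hab => ⟨?_, ?_⟩⟩
    · have := H0 a ha b hb (hab.trans_le (min_le_left _ _))
      rwa [remainder_eq (Nat.zero_le _), Function.iterate_zero_apply, iteratedDeriv_zero,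
        Nat.sub_zero] at this
    · have := H1 a ha b hb (hab.trans_le (min_le_right _ _))
      rwa [remainder_eq hm, Function.iterate_one, iteratedDeriv_one] at this
  obtain ⟨δ0, h0, H0⟩ := Wh hf
  obtain ⟨δ1, h1, H1⟩ := Wh hg
  refine ⟨min δ0 δ1, lt_min h0 h1, fun a ha b hb hab hd => ?_⟩
  set P := taylorPoly m (fun k => iteratedDeriv k f) a with hP
  set Q := taylorPoly m (fun k => iteratedDeriv k g) a with hQ
  have hP0 : P.eval a = f a := by
    simpa using taylorPoly_iterate_derivative_eval_self (Nat.zero_le m)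
      (fun k => iteratedDeriv k f) a
  have hQ0 : Q.eval a = g a := by
    simpa using taylorPoly_iterate_derivative_eval_self (Nat.zero_le m)
      (fun k => iteratedDeriv k g) a
  have hL : 0 < b - a := sub_pos.2 hab
  have bd : ∀ x ∈ Icc a b, (|f x - P.eval x| ≤ ε * (b - a) ^ m ∧
      |deriv f x - P.derivative.eval x| ≤ ε * (b - a) ^ (m - 1)) ∧
      |g x - Q.eval x| ≤ ε * (b - a) ^ m ∧
      |deriv g x - Q.derivative.eval x| ≤ ε * (b - a) ^ (m - 1) := by
    intro x hx
    have hxc : x ∈ Icc c d := ⟨ha.1.trans hx.1, hx.2.trans hb.2⟩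
    have hax : |a - x| ≤ b - a := by
      rw [abs_sub_comm, abs_of_nonneg (by linarith [hx.1])]; linarith [hx.2]
    have i1 : ε * |a - x| ^ m ≤ ε * (b - a) ^ m := by gcongr
    have i2 : ε * |a - x| ^ (m - 1) ≤ ε * (b - a) ^ (m - 1) := by gcongr
    have k0 := H0 a ha x hxc (hax.trans_lt (hd.trans_le (min_le_left _ _)))
    have k1 := H1 a ha x hxc (hax.trans_lt (hd.trans_le (min_le_right _ _)))
    exact ⟨⟨k0.1.trans i1, k0.2.trans i2⟩, k1.1.trans i1, k1.2.trans i2⟩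
  have df : ∀ x, HasDerivAt f (deriv f x) x := fun x =>
    ((C1 hf).differentiable one_ne_zero x).hasDerivAt
  have dg : ∀ x, HasDerivAt g (deriv g x) x := fun x =>
    ((C1 hg).differentiable one_ne_zero x).hasDerivAt
  have dh : ∀ x, HasDerivAt h (deriv h x) x := fun x =>
    ((C1 hh).differentiable one_ne_zero x).hasDerivAt
  have cf := (C1 hf).continuous_deriv le_rfl
  have cg := (C1 hg).continuous_deriv le_rfl
  have ch := (C1 hh).continuous_deriv le_rfl
  have key := area_expand hab.le (p := fun x => P.eval x) (q := fun x => Q.eval x)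
    (r := fun x => f x - P.eval x) (s := fun x => g x - Q.eval x)
    (r' := fun x => deriv f x - P.derivative.eval x)
    (s' := fun x => deriv g x - Q.derivative.eval x)
    (fun x => P.hasDerivAt x) (fun x => Q.hasDerivAt x)
    (fun x => (df x).sub (P.hasDerivAt x)) (fun x => (dg x).sub (Q.hasDerivAt x))
    (by fun_prop) (by fun_prop) (by fun_prop) (by fun_prop)
    (by simp [hP0]) (by simp [hQ0])
    (fun x hx => (bd x hx).1.1) (fun x hx => (bd x hx).2.1)
    (fun x hx => (bd x hx).1.2) (fun x hx => (bd x hx).2.2)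
  simp only [add_sub_cancel, hP0, hQ0] at key
  have hint : h b - h a = 2 * ∫ x in a..b, (deriv f x * g x - deriv g x * f x) := by
    rw [← intervalIntegral.integral_const_mul,
      ← intervalIntegral.integral_eq_sub_of_hasDerivAt (fun x _ => dh x)
        (ch.intervalIntegrable _ _)]
    simp only [hor]
  have pw : (b - a) ^ m * (b - a) ^ (m - 1) * (b - a) = (b - a) ^ (2 * m) := by
    rw [mul_assoc, ← pow_succ, ← pow_add]; congr 1; omega
  simp only [areaDiscrepancy, velocity, iteratedDeriv_zero, ← hP, ← hQ]
  set I := ∫ x in a..b, (|P.derivative.eval x| + |Q.derivative.eval x|)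
  have hI : 0 ≤ I := intervalIntegral.integral_nonneg hab.le fun x _ => by positivity
  set W := ∫ x in a..b, (deriv f x * g x - deriv g x * f x)
  set Z := ∫ x in a..b, (P.derivative.eval x * Q.eval x - Q.derivative.eval x * P.eval x)
  have e1 : h b - h a - 2 * Z + 2 * f a * (g b - Q.eval b) - 2 * g a * (f b - P.eval b)
      = 2 * (W - Z - (f b - P.eval b) * g a + (g b - Q.eval b) * f a) := by rw [hint]; ring
  rw [e1, abs_mul, abs_two]
  have e2 : 3 * (ε * (b - a) ^ m) * I + 2 * (ε * (b - a) ^ m) * (ε * (b - a) ^ (m - 1)) * (b - a)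
      = 3 * ε * ((b - a) ^ m * I) + 2 * ε ^ 2 * (b - a) ^ (2 * m) := by rw [← pw]; ring
  rw [e2] at key
  have i3 : 0 ≤ (b - a) ^ m * I := by positivity
  have i4 : 0 ≤ (b - a) ^ (2 * m) := by positivity
  nlinarith [mul_nonneg hε.le i3, mul_nonneg hε.le i4,
    mul_nonneg (mul_nonneg hε.le (sub_nonneg.2 hε1)) i4]

lemma necessity {m : ℕ} (hm : 1 ≤ m) {K : Set ℝ} (hK : IsCompact K) {F G H : ℕ → ℝ → ℝ}
    {f g h : ℝ → ℝ} (hE : ExtendsTo m K F G H f g h) :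
    (IsWhitneyField m K F ∧ IsWhitneyField m K G ∧ IsWhitneyField m K H) ∧
      (∀ k : ℕ, 1 ≤ k → k ≤ m → ∀ t ∈ K,
        H k t = MvPolynomial.eval (Sum.elim (fun j => F j t) (fun j => G j t)) (horizPoly k)) ∧
      (∀ ε : ℝ, 0 < ε → ∃ δ : ℝ, 0 < δ ∧ ∀ a ∈ K, ∀ b ∈ K, a < b → b - a < δ →
        |areaDiscrepancy m F G H a b / velocity m F G a b| < ε) := by
  obtain ⟨hC, hhor, hJ⟩ := hE
  obtain ⟨hf, hg, hh⟩ := contDiff_triple_iff.1 hC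
  have hm' : (1 : WithTop ℕ∞) ≤ m := by exact_mod_cast hm
  have hor := (isHorizontalCurve_iff (hf.of_le hm') (hg.of_le hm') (hh.of_le hm')).1 hhor
  refine ⟨⟨isWhitneyField_of_extension hK hf fun k hk x hx => (hJ k hk x hx).1,
    isWhitneyField_of_extension hK hg fun k hk x hx => (hJ k hk x hx).2.1,
    isWhitneyField_of_extension hK hh fun k hk x hx => (hJ k hk x hx).2.2⟩, ?_, ?_⟩
  · intro k hk hkm t ht
    rw [← (hJ k hkm t ht).2.2, iteratedDeriv_of_horizontal hf hg hor hk hkm]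
    exact eval_horizPoly_congr hkm (fun j hj => (hJ j hj t ht).1) fun j hj => (hJ j hj t ht).2.1
  · intro ε hε
    obtain ⟨c, d, hcd⟩ := exists_Icc_of_isCompact hK
    obtain ⟨δ, hδ, D⟩ := abs_areaDiscrepancy_le hm hf hg hh hor c d
      (ε := min 1 (ε / 20)) (by positivity) (min_le_left _ _)
    refine ⟨δ, hδ, fun a ha b hb hab hd => ?_⟩
    have hV := velocity_pos (m := m) F G hab
    have := D a (hcd ha) b (hcd hb) hab hd
    have eF : taylorPoly m (fun k => iteratedDeriv k f) a = taylorPoly m F a :=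
      taylorPoly_congr fun j hj => (hJ j hj a ha).1
    have eG : taylorPoly m (fun k => iteratedDeriv k g) a = taylorPoly m G a :=
      taylorPoly_congr fun j hj => (hJ j hj a ha).2.1
    have z := fun x hx => hJ 0 (Nat.zero_le _) x hx
    rw [areaDiscrepancy, velocity, eF, eG, (z a ha).1, (z a ha).2.1, (z a ha).2.2, (z b hb).1,
      (z b hb).2.1, (z b hb).2.2, ← areaDiscrepancy, ← velocity] at this
    rw [abs_div, abs_of_pos hV, div_lt_iff₀ hV]
    refine this.trans_lt (mul_lt_mul_of_pos_right ?_ hV)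
    linarith [min_le_right 1 (ε / 20)]

/-! ### Quadratic equations with controlled roots -/

/-- Of the two real roots, take the one for which `B t` has the sign of `E`. Then nothing cancels
and the quadratic term alone is at most `|E|`, a bound that does not involve `B`. -/
lemma exists_quadratic_root_of_mul_nonneg {κ E : ℝ} (B : ℝ) (hκ : κ ≠ 0) (h : 0 ≤ κ * E) :
    ∃ t : ℝ, κ * t ^ 2 + B * t = E ∧ |κ| * t ^ 2 ≤ |E| := by
  have main : ∀ {κ E B : ℝ}, 0 < κ → 0 ≤ E → 0 ≤ B →
      ∃ t : ℝ, κ * t ^ 2 + B * t = E ∧ κ * t ^ 2 ≤ E := by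
    intro κ E B hκ hE hB
    have hs : 0 ≤ B ^ 2 + 4 * κ * E := by positivity
    have hsq := Real.sq_sqrt hs
    have hge : B ≤ √(B ^ 2 + 4 * κ * E) := Real.le_sqrt_of_sq_le (by nlinarith [mul_nonneg hκ.le hE])
    set S := √(B ^ 2 + 4 * κ * E)
    have e : κ * ((S - B) / (2 * κ)) ^ 2 + B * ((S - B) / (2 * κ)) = E := by
      field_simp; linear_combination hsq
    have h0 : 0 ≤ B * ((S - B) / (2 * κ)) :=
      mul_nonneg hB (div_nonneg (sub_nonneg.2 hge) (by positivity))
    exact ⟨_, e, by linarith⟩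
  have main' : ∀ {κ E B : ℝ}, 0 < κ → 0 ≤ E →
      ∃ t : ℝ, κ * t ^ 2 + B * t = E ∧ κ * t ^ 2 ≤ E := by
    intro κ E B hκ hE
    rcases le_total 0 B with hB | hB
    · exact main hκ hE hB
    · obtain ⟨t, h1, h2⟩ := main hκ hE (neg_nonneg.2 hB)
      exact ⟨-t, by linear_combination h1, by rwa [neg_sq]⟩
  rcases lt_or_gt_of_ne hκ with hk | hk
  · have hE : E ≤ 0 := nonpos_of_mul_nonneg_right h hk
    obtain ⟨t, h1, h2⟩ := main' (B := -B) (neg_pos.2 hk) (neg_nonneg.2 hE)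
    exact ⟨t, by linear_combination -h1, by rwa [abs_of_neg hk, abs_of_nonpos hE]⟩
  · have hE : 0 ≤ E := nonneg_of_mul_nonneg_right h hk
    obtain ⟨t, h1, h2⟩ := main' (B := B) hk hE
    exact ⟨t, h1, by rwa [abs_of_pos hk, abs_of_nonneg hE]⟩

/-- On `[-T, T]` with `T = 2 |E| / B` the linear term dominates: at the ends it is `±2 |E|` while
the quadratic term is at most `|E|`. The intermediate value theorem gives the root. -/
lemma exists_quadratic_root_of_small {κ E B : ℝ} (hB : 0 < B) (h : 4 * |E| * |κ| ≤ B ^ 2) :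
    ∃ t : ℝ, κ * t ^ 2 + B * t = E ∧ |t| ≤ 2 * |E| / B := by
  set T := 2 * |E| / B with hT
  have hT0 : 0 ≤ T := by positivity
  have hBT : B * T = 2 * |E| := by rw [hT]; field_simp
  have hk : |κ| * T ^ 2 ≤ |E| := by
    have : |κ| * T ^ 2 * B ^ 2 ≤ |E| * B ^ 2 := by
      have e : |κ| * T ^ 2 * B ^ 2 = |E| * (4 * |E| * |κ|) := by
        linear_combination |κ| * (B * T + 2 * |E|) * hBT
      rw [e]; gcongr
    exact le_of_mul_le_mul_right this (by positivity)
  have h1 := abs_le.1 (le_refl |κ|)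
  have hT2 : 0 ≤ T ^ 2 := sq_nonneg T
  have hkT : |κ * T ^ 2| ≤ |E| := by rwa [abs_mul, abs_of_nonneg hT2]
  rw [abs_le] at hkT
  have hE := abs_le.1 (le_refl |E|)
  have hmem : E ∈ Icc (κ * (-T) ^ 2 + B * (-T)) (κ * T ^ 2 + B * T) := by
    constructor
    · rw [neg_sq]; linarith
    · linarith
  obtain ⟨t, ht, hte⟩ := intermediate_value_Icc (f := fun t => κ * t ^ 2 + B * t)
    (neg_le_self hT0) (by fun_prop) hmem
  exact ⟨t, hte, abs_le.2 ht⟩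

/-! ### Flat perturbations: the quadratic regime -/

/-- A polynomial flat to order `m` at both ends of the unit interval and positive inside. -/
noncomputable def bump (m : ℕ) : ℝ[X] := X ^ (m + 1) * (1 - X) ^ (m + 1)

lemma iterate_derivative_eval_eq_zero {m k : ℕ} {p : ℝ[X]} {a : ℝ}
    (h : (X - C a) ^ (m + 1) ∣ p) (hk : k ≤ m) : (derivative^[k] p).eval a = 0 := by
  have := pow_sub_dvd_iterate_derivative_of_pow_dvd k h
  obtain ⟨q, hq⟩ := (dvd_pow_self (X - C a) (by omega : m + 1 - k ≠ 0)).trans this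
  rw [hq]; simp

/-- The derivatives of `p` of order at most `m` vanish at `0` and `1`. -/
def FlatEnds (m : ℕ) (p : ℝ[X]) : Prop :=
  ∀ k ≤ m, (derivative^[k] p).eval 0 = 0 ∧ (derivative^[k] p).eval 1 = 0

lemma FlatEnds.const_mul {m : ℕ} {p : ℝ[X]} (h : FlatEnds m p) (c : ℝ) : FlatEnds m (C c * p) :=
  fun k hk => by simp [iterate_derivative_C_mul, h k hk]

lemma FlatEnds.eval_zero {m : ℕ} {p : ℝ[X]} (h : FlatEnds m p) : p.eval 0 = 0 :=
  (h 0 (Nat.zero_le _)).1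

lemma FlatEnds.eval_one {m : ℕ} {p : ℝ[X]} (h : FlatEnds m p) : p.eval 1 = 0 :=
  (h 0 (Nat.zero_le _)).2

lemma flatEnds_bump_mul (m : ℕ) (p : ℝ[X]) : FlatEnds m (bump m * p) := by
  intro k hk
  refine ⟨iterate_derivative_eval_eq_zero ?_ hk, iterate_derivative_eval_eq_zero ?_ hk⟩
  · rw [C_0, sub_zero, bump, mul_assoc]; exact dvd_mul_right _ _
  · have : (X - C 1 : ℝ[X]) ^ (m + 1) ∣ (1 - X) ^ (m + 1) := by
      apply pow_dvd_pow_of_dvd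
      exact ⟨-1, by rw [C_1]; ring⟩
    exact (this.mul_left _).mul_right _

lemma bump_eval (m : ℕ) (x : ℝ) : (bump m).eval x = x ^ (m + 1) * (1 - x) ^ (m + 1) := by
  simp [bump]

lemma bump_eval_nonneg (m : ℕ) {x : ℝ} (hx : x ∈ Icc (0 : ℝ) 1) : 0 ≤ (bump m).eval x := by
  rw [bump_eval]
  have := hx.1
  have : 0 ≤ 1 - x := sub_nonneg.2 hx.2
  positivity

lemma bump_eval_pos (m : ℕ) {x : ℝ} (hx : x ∈ Ioo (0 : ℝ) 1) : 0 < (bump m).eval x := by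
  rw [bump_eval]
  have := hx.1
  have : 0 < 1 - x := sub_pos.2 hx.2
  positivity

/-- The signed area swept by the plane curve `(p, q)` on the unit interval. -/
noncomputable def polyArea (p q : ℝ[X]) : ℝ :=
  ∫ x in (0 : ℝ)..1, (p.derivative.eval x * q.eval x - q.derivative.eval x * p.eval x)

lemma intervalIntegrable_eval (p : ℝ[X]) (a b : ℝ) :
    IntervalIntegrable (fun x => p.eval x) MeasureTheory.volume a b :=
  p.continuous.intervalIntegrable _ _

/-- Flatness kills the boundary terms of the integration by parts, so the two cross terms merge into
one, with the factor `2`. Prescribing the area becomes a quadratic equation in `t`. -/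
lemma polyArea_add_flat {m : ℕ} {p q φ ψ : ℝ[X]} (hφ : FlatEnds m φ) (hψ : FlatEnds m ψ) (t : ℝ) :
    polyArea (p + C t * φ) (q + C t * ψ) = polyArea p q
      + 2 * (∫ x in (0 : ℝ)..1, (p.derivative.eval x * ψ.eval x - q.derivative.eval x * φ.eval x)) * t
      + polyArea φ ψ * t ^ 2 := by
  have ftc : ∫ x in (0 : ℝ)..1, (φ * q - ψ * p).derivative.eval x = 0 := by
    rw [intervalIntegral.integral_eq_sub_of_hasDerivAt
      (fun x _ => (φ * q - ψ * p).hasDerivAt x) (intervalIntegrable_eval _ _ _)]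
    simp [hφ.eval_zero, hφ.eval_one, hψ.eval_zero, hψ.eval_one]
  have e : ∀ x : ℝ, ((p + C t * φ).derivative.eval x * (q + C t * ψ).eval x
      - (q + C t * ψ).derivative.eval x * (p + C t * φ).eval x)
      = (p.derivative.eval x * q.eval x - q.derivative.eval x * p.eval x)
      + 2 * t * (p.derivative.eval x * ψ.eval x - q.derivative.eval x * φ.eval x)
      + t ^ 2 * (φ.derivative.eval x * ψ.eval x - ψ.derivative.eval x * φ.eval x)
      + t * (φ * q - ψ * p).derivative.eval x := by
    intro x; simp; ring
  have i : ∀ {f : ℝ → ℝ}, Continuous f → IntervalIntegrable f MeasureTheory.volume 0 1 :=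
    fun h => h.intervalIntegrable _ _
  simp only [polyArea, e]
  rw [intervalIntegral.integral_add (i (by fun_prop)) (i (by fun_prop)),
    intervalIntegral.integral_add (i (by fun_prop)) (i (by fun_prop)),
    intervalIntegral.integral_add (i (by fun_prop)) (i (by fun_prop)),
    intervalIntegral.integral_const_mul, intervalIntegral.integral_const_mul,
    intervalIntegral.integral_const_mul, ftc]
  ring

lemma exists_bound_unit (p : ℝ[X]) : ∃ C : ℝ, 0 < C ∧ ∀ x ∈ Icc (0 : ℝ) 1, |p.eval x| ≤ C := by
  obtain ⟨C, hC⟩ := isCompact_Icc.exists_bound_of_continuousOn (p.continuous.continuousOn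
    (s := Icc (0 : ℝ) 1))
  exact ⟨max C 1, by positivity, fun x hx => (hC x hx).trans (le_max_left _ _)⟩

lemma polyArea_neg_right (p q : ℝ[X]) : polyArea p (-q) = -polyArea p q := by
  simp only [polyArea, ← intervalIntegral.integral_neg]
  congr 1; ext x; simp; ring

lemma polyArea_bump (m : ℕ) :
    polyArea (bump m) (bump m * X) = -∫ x in (0 : ℝ)..1, (bump m).eval x ^ 2 := by
  simp only [polyArea, ← intervalIntegral.integral_neg]
  congr 1; ext x; simp; ring

lemma polyArea_bump_neg (m : ℕ) : polyArea (bump m) (bump m * X) < 0 := by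
  rw [polyArea_bump, neg_lt_zero]
  refine intervalIntegral.integral_pos one_pos (by fun_prop) (fun x _ => by positivity)
    ⟨1 / 2, by norm_num, ?_⟩
  have := bump_eval_pos m (x := 1 / 2) (by norm_num)
  positivity

/-- Any area can be attained by a flat perturbation, whose top derivative is bounded by the
square root of the prescribed change of area. -/
lemma exists_flat_quadratic (m : ℕ) : ∃ C : ℝ, 0 < C ∧ ∀ (p q : ℝ[X]) (A : ℝ),
    ∃ φ ψ : ℝ[X], FlatEnds m φ ∧ FlatEnds m ψ ∧ polyArea (p + φ) (q + ψ) = A ∧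
      ∀ x ∈ Icc (0 : ℝ) 1, (derivative^[m] φ).eval x ^ 2 ≤ C * |A - polyArea p q| ∧
        (derivative^[m] ψ).eval x ^ 2 ≤ C * |A - polyArea p q| := by
  obtain ⟨C₁, hC₁, b₁⟩ := exists_bound_unit (derivative^[m] (bump m))
  obtain ⟨C₂, hC₂, b₂⟩ := exists_bound_unit (derivative^[m] (bump m * X))
  have hκ := polyArea_bump_neg m
  set κ := polyArea (bump m) (bump m * X) with hκd
  have f₁ : FlatEnds m (bump m) := by simpa using flatEnds_bump_mul m 1
  have f₂ := flatEnds_bump_mul m X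
  have f₃ : FlatEnds m (-(bump m * X)) := by simpa using f₂.const_mul (-1)
  set D := max C₁ C₂
  have hD : 0 < D := lt_max_of_lt_left hC₁
  refine ⟨D ^ 2 / |κ|, by have := abs_pos.2 hκ.ne; positivity, fun p q A => ?_⟩
  -- The loop `(bump, ψ₀)` is used with `ψ₀ = ± bump * X`; the sign makes its area agree in sign
  -- with the deficit, as the root bound requires.
  have main : ∀ ψ₀ : ℝ[X], FlatEnds m ψ₀ → 0 ≤ polyArea (bump m) ψ₀ * (A - polyArea p q) →
      |polyArea (bump m) ψ₀| = |κ| →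
      (∀ x ∈ Icc (0 : ℝ) 1, |(derivative^[m] ψ₀).eval x| ≤ D) →
      ∃ φ ψ : ℝ[X], FlatEnds m φ ∧ FlatEnds m ψ ∧ polyArea (p + φ) (q + ψ) = A ∧
      ∀ x ∈ Icc (0 : ℝ) 1, (derivative^[m] φ).eval x ^ 2 ≤ D ^ 2 / |κ| * |A - polyArea p q| ∧
        (derivative^[m] ψ).eval x ^ 2 ≤ D ^ 2 / |κ| * |A - polyArea p q| := by
    intro ψ₀ hf hs hk hb
    obtain ⟨t, ht, ht2⟩ := exists_quadratic_root_of_mul_nonneg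
      (2 * ∫ x in (0 : ℝ)..1, (p.derivative.eval x * ψ₀.eval x
        - q.derivative.eval x * (bump m).eval x)) (by rw [← abs_pos, hk]; exact abs_pos.2 hκ.ne) hs
    have est : ∀ u : ℝ, |u| ≤ D → (t * u) ^ 2 ≤ D ^ 2 / |κ| * |A - polyArea p q| := by
      intro u hu
      rw [hk] at ht2
      have h1 : u ^ 2 ≤ D ^ 2 := sq_le_sq' (abs_le.1 hu).1 (abs_le.1 hu).2
      have hκ' := abs_pos.2 hκ.ne
      rw [div_mul_eq_mul_div, le_div_iff₀ hκ']
      calc (t * u) ^ 2 * |κ| = u ^ 2 * (|κ| * t ^ 2) := by ring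
        _ ≤ D ^ 2 * |A - polyArea p q| := by gcongr
    refine ⟨C t * bump m, C t * ψ₀, f₁.const_mul t, hf.const_mul t, ?_, fun x hx => ⟨?_, ?_⟩⟩
    · rw [polyArea_add_flat f₁ hf]; linarith
    · rw [iterate_derivative_C_mul, eval_mul, eval_C]
      exact est _ ((b₁ x hx).trans (le_max_left _ _))
    · rw [iterate_derivative_C_mul, eval_mul, eval_C]
      exact est _ (hb x hx)
  rcases le_total 0 (A - polyArea p q) with hE | hE
  · refine main _ f₃ ?_ (by rw [polyArea_neg_right, abs_neg]) fun x hx => ?_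
    · rw [polyArea_neg_right]
      exact mul_nonneg (neg_nonneg.2 hκ.le) hE
    · rw [iterate_derivative_neg, eval_neg, abs_neg]
      exact (b₂ x hx).trans (le_max_right _ _)
  · exact main _ f₂ (mul_nonneg_of_nonpos_of_nonpos hκ.le hE) rfl
      fun x hx => (b₂ x hx).trans (le_max_right _ _)

/-! ### Flat perturbations: the linear regime -/

/-- The polynomial with coefficient vector `u`. -/
noncomputable def polyOf {m : ℕ} (u : Fin m → ℝ) : ℝ[X] := ∑ i, C (u i) * X ^ (i : ℕ)

lemma polyOf_eval {m : ℕ} (u : Fin m → ℝ) (x : ℝ) : (polyOf u).eval x = ∑ i, u i * x ^ (i : ℕ) := by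
  simp [polyOf, eval_finsetSum]

lemma polyOf_coeff {m : ℕ} {p : ℝ[X]} (h : p.natDegree < m) :
    polyOf (fun i : Fin m => p.coeff i) = p := by
  conv_rhs => rw [as_sum_range' p m h]
  rw [polyOf, ← Fin.sum_univ_eq_sum_range (fun i => monomial i (p.coeff i))]
  simp [C_mul_X_pow_eq_monomial]

lemma polyOf_injective {m : ℕ} {u : Fin m → ℝ} (h : polyOf u = 0) : u = 0 := by
  ext i
  have : (polyOf u).coeff i = 0 := by rw [h, coeff_zero]
  simpa [polyOf, finsetSum_coeff, coeff_C_mul, coeff_X_pow, Fin.val_inj] using this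

/-- The right side is a positive definite quadratic form on a finite-dimensional space: it is
bounded below on the compact unit sphere, and homogeneity does the rest. The constant depends on `m`
only, which makes the repair uniform over all gaps. -/
lemma exists_weighted_lower_bound (m : ℕ) : ∃ c : ℝ, 0 < c ∧ ∀ u : Fin m → ℝ,
    c * ‖u‖ ^ 2 ≤ ∫ x in (0 : ℝ)..1, (bump m).eval x * (polyOf u).eval x ^ 2 := by
  set J : (Fin m → ℝ) → ℝ := fun u =>
    ∫ x in (0 : ℝ)..1, (bump m).eval x * (polyOf u).eval x ^ 2 with hJ
  have cont : Continuous J := by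
    apply intervalIntegral.continuous_parametric_intervalIntegral_of_continuous'
    simp only [Function.uncurry_def, polyOf_eval]
    fun_prop
  have pos : ∀ u, u ≠ 0 → 0 < J u := by
    intro u hu
    obtain ⟨x, hx, hxr⟩ : ∃ x ∈ Ioo (0 : ℝ) 1, (polyOf u).eval x ≠ 0 := by
      by_contra! hcon
      exact hu (polyOf_injective (eq_zero_of_infinite_isRoot _
        ((Ioo_infinite one_pos).mono hcon)))
    refine intervalIntegral.integral_pos one_pos (by fun_prop) (fun y hy => ?_)
      ⟨x, Ioo_subset_Icc_self hx, ?_⟩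
    · exact mul_nonneg (bump_eval_nonneg m (Ioc_subset_Icc_self hy)) (sq_nonneg _)
    · have := bump_eval_pos m hx
      positivity
  have hom : ∀ (t : ℝ) u, J (t • u) = t ^ 2 * J u := by
    intro t u
    simp only [hJ, ← intervalIntegral.integral_const_mul]
    congr 1; ext x
    simp only [polyOf_eval, Pi.smul_apply, smul_eq_mul, mul_assoc, ← Finset.mul_sum]
    ring
  have key : ∃ c : ℝ, 0 < c ∧ ∀ u ∈ Metric.sphere (0 : Fin m → ℝ) 1, c ≤ J u := by
    -- For `m = 0` the sphere is empty and has no minimiser.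
    rcases (Metric.sphere (0 : Fin m → ℝ) 1).eq_empty_or_nonempty with he | hne
    · exact ⟨1, one_pos, by simp [he]⟩
    · obtain ⟨u, hu, hmin⟩ := (isCompact_sphere (0 : Fin m → ℝ) 1).exists_isMinOn hne
        cont.continuousOn
      refine ⟨J u, pos u ?_, fun v hv => hmin hv⟩
      rintro rfl
      simp at hu
  obtain ⟨c, hc, hcs⟩ := key
  refine ⟨c, hc, fun u => ?_⟩
  rcases eq_or_ne u 0 with rfl | hu
  · have := hom 0 0
    rw [smul_zero] at this
    change _ ≤ J 0
    rw [this]; simp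
  · have hn : ‖u‖ ≠ 0 := norm_ne_zero_iff.2 hu
    have h1 := hcs (‖u‖⁻¹ • u) (by simp [norm_smul, hn])
    have h2 := hom ‖u‖ (‖u‖⁻¹ • u)
    rw [smul_smul, mul_inv_cancel₀ hn, one_smul] at h2
    change _ ≤ J u
    rw [h2, mul_comm]
    gcongr

lemma exists_polyOf_bound (m : ℕ) (T : ℝ[X] →ₗ[ℝ] ℝ[X]) : ∃ C : ℝ, 0 < C ∧ ∀ u : Fin m → ℝ,
    ∀ x ∈ Icc (0 : ℝ) 1, |(T (polyOf u)).eval x| ≤ C * ‖u‖ := by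
  choose B hB b using fun i : Fin m => exists_bound_unit (T (X ^ (i : ℕ)))
  refine ⟨∑ i, B i + 1, by have := Finset.sum_nonneg fun i (_ : i ∈ Finset.univ) => (hB i).le; linarith,
    fun u x hx => ?_⟩
  have e : (T (polyOf u)).eval x = ∑ i, u i * (T (X ^ (i : ℕ))).eval x := by
    simp [polyOf, ← smul_eq_C_mul, map_sum, eval_finsetSum]
  rw [e]
  calc |∑ i, u i * (T (X ^ (i : ℕ))).eval x| ≤ ∑ i, |u i * (T (X ^ (i : ℕ))).eval x| :=
        Finset.abs_sum_le_sum_abs _ _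
    _ ≤ ∑ i, B i * ‖u‖ := by
        refine Finset.sum_le_sum fun i _ => ?_
        rw [abs_mul, mul_comm]
        exact mul_le_mul (b i x hx) (norm_le_pi_norm u i) (abs_nonneg _) (hB i).le
    _ ≤ _ := by rw [← Finset.sum_mul]; nlinarith [norm_nonneg u]

lemma abs_integral_unit_le {f : ℝ → ℝ} {C : ℝ} (h : ∀ x ∈ Icc (0 : ℝ) 1, |f x| ≤ C) :
    |∫ x in (0 : ℝ)..1, f x| ≤ C := by
  have := intervalIntegral.norm_integral_le_of_norm_le_const (a := (0 : ℝ)) (b := 1) (f := f)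
    (C := C) fun x hx => h x (by
      rw [uIoc_of_le zero_le_one] at hx; exact Ioc_subset_Icc_self hx)
  simpa using this

lemma abs_mul_le_mul {u v c d : ℝ} (h₁ : |u| ≤ c) (h₂ : |v| ≤ d) : |u * v| ≤ c * d := by
  rw [abs_mul]
  exact mul_le_mul h₁ h₂ (abs_nonneg _) ((abs_nonneg _).trans h₁)

/-- If the velocity is not too small, a small change of area is attained by a small flat
perturbation along the rotated velocity. -/
lemma exists_flat_linear {m : ℕ} (hm : 1 ≤ m) : ∃ C ε₀ : ℝ, 0 < C ∧ 0 < ε₀ ∧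
    ∀ (P Q r s : ℝ[X]) (l ε A : ℝ), P.natDegree ≤ m → Q.natDegree ≤ m → 0 < l → 0 ≤ ε → ε ≤ ε₀ →
    (∀ x ∈ Icc (0 : ℝ) 1, |r.derivative.eval x| ≤ ε * l) →
    (∀ x ∈ Icc (0 : ℝ) 1, |s.derivative.eval x| ≤ ε * l) →
    l ≤ (∫ x in (0 : ℝ)..1, (|P.derivative.eval x| + |Q.derivative.eval x|)) →
    |A - polyArea (P + r) (Q + s)|
      ≤ ε * l * (∫ x in (0 : ℝ)..1, (|P.derivative.eval x| + |Q.derivative.eval x|)) →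
    ∃ φ ψ : ℝ[X], FlatEnds m φ ∧ FlatEnds m ψ ∧ polyArea (P + r + φ) (Q + s + ψ) = A ∧
      ∀ x ∈ Icc (0 : ℝ) 1, |(derivative^[m] φ).eval x| ≤ C * ε * l ∧
        |(derivative^[m] ψ).eval x| ≤ C * ε * l := by
  obtain ⟨c, hc, low⟩ := exists_weighted_lower_bound m
  obtain ⟨C₁, hC₁, b₁⟩ := exists_polyOf_bound m LinearMap.id
  choose C₂ hC₂ b₂ using fun k => exists_polyOf_bound m
    ((derivative ^ k : Module.End ℝ ℝ[X]) ∘ₗ LinearMap.mulLeft ℝ (bump m))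
  set C := C₁ + C₂ 0 + C₂ 1 + C₂ m with hCd
  have hC : 0 < C := by have := hC₂ 0; have := hC₂ 1; have := hC₂ m; positivity
  have bp : ∀ (u : Fin m → ℝ), ∀ x ∈ Icc (0 : ℝ) 1, |(polyOf u).eval x| ≤ C * ‖u‖ ∧
      |(bump m * polyOf u).eval x| ≤ C * ‖u‖ ∧
      |(bump m * polyOf u).derivative.eval x| ≤ C * ‖u‖ ∧
      |(derivative^[m] (bump m * polyOf u)).eval x| ≤ C * ‖u‖ := by
    intro u x hx
    have h0 := hC₂ 0
    have h1 := hC₂ 1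
    have h2 := hC₂ m
    have g0 := b₂ 0 u x hx
    have g1 := b₂ 1 u x hx
    have g2 := b₂ m u x hx
    simp only [LinearMap.comp_apply, LinearMap.mulLeft_apply, Module.End.pow_apply,
      Function.iterate_zero_apply, Function.iterate_one] at g0 g1 g2
    have mono : ∀ {D : ℝ}, D ≤ C → D * ‖u‖ ≤ C * ‖u‖ := fun h =>
      mul_le_mul_of_nonneg_right h (norm_nonneg u)
    exact ⟨(b₁ u x hx).trans (mono (by linarith)), g0.trans (mono (by linarith)),
      g1.trans (mono (by linarith)), g2.trans (mono (by linarith))⟩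
  -- The first threshold keeps the contribution of `r`, `s` to the linear coefficient below half of
  -- the main term; the second is the smallness condition of `exists_quadratic_root_of_small`.
  refine ⟨4 * C ^ 2 / c, min (c / (8 * C ^ 2)) (c ^ 2 / (32 * C ^ 4)), by positivity,
    by positivity, ?_⟩
  intro P Q r s l ε A hP hQ hl hε hε₀ hr hs hlI hA
  have hε₁ : ε * (8 * C ^ 2) ≤ c := (le_div_iff₀ (by positivity)).1 (hε₀.trans (min_le_left _ _))
  have hε₂ : ε * (32 * C ^ 4) ≤ c ^ 2 :=
    (le_div_iff₀ (by positivity)).1 (hε₀.trans (min_le_right _ _))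
  obtain ⟨u, hu⟩ : ∃ u : Fin m → ℝ, polyOf u = P.derivative :=
    ⟨_, polyOf_coeff ((natDegree_derivative_le P).trans_lt (by omega))⟩
  obtain ⟨v, hv⟩ : ∃ v : Fin m → ℝ, polyOf v = Q.derivative :=
    ⟨_, polyOf_coeff ((natDegree_derivative_le Q).trans_lt (by omega))⟩
  set I := ∫ x in (0 : ℝ)..1, (|P.derivative.eval x| + |Q.derivative.eval x|) with hI
  set N := max ‖u‖ ‖v‖ with hN
  have huN : C * ‖u‖ ≤ C * N := by gcongr; exact le_max_left _ _
  have hvN : C * ‖v‖ ≤ C * N := by gcongr; exact le_max_right _ _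
  -- `N` measures the velocity. All later bounds are powers of `N` that cancel, so the outcome
  -- depends only on `ε * l`.
  have hIN : I ≤ 2 * C * N := by
    refine (le_abs_self _).trans (abs_integral_unit_le fun x hx => ?_)
    rw [← hu, ← hv, abs_of_nonneg (by positivity)]
    linarith [(bp u x hx).1, (bp v x hx).1]
  have hNpos : 0 < N := by
    by_contra! h
    nlinarith
  -- The direction is the rotated velocity `(-Q', P')` times the bump, so the first variation of
  -- area is `2 ∫ bump (P'² + Q'²)` up to the terms in `r'`, `s'`.
  set φ₀ := bump m * polyOf (-v) with hφ₀
  set ψ₀ := bump m * polyOf u with hψ₀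
  have fφ : FlatEnds m φ₀ := flatEnds_bump_mul m _
  have fψ : FlatEnds m ψ₀ := flatEnds_bump_mul m _
  have hneg : polyOf (-v) = -polyOf v := by simp [polyOf]
  have bφ := fun x hx => bp (-v) x hx
  rw [norm_neg] at bφ
  have bψ := fun x hx => bp u x hx
  rw [← hφ₀] at bφ
  rw [← hψ₀] at bψ
  set B := 2 * ∫ x in (0 : ℝ)..1, ((P + r).derivative.eval x * ψ₀.eval x
    - (Q + s).derivative.eval x * φ₀.eval x) with hB
  have hBlow : c * N ^ 2 ≤ B := by
    have e : ∀ x : ℝ, (P + r).derivative.eval x * ψ₀.eval x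
        - (Q + s).derivative.eval x * φ₀.eval x
        = ((bump m).eval x * (polyOf u).eval x ^ 2 + (bump m).eval x * (polyOf v).eval x ^ 2)
          + (r.derivative.eval x * ψ₀.eval x - s.derivative.eval x * φ₀.eval x) := by
      intro x
      simp only [derivative_add, eval_add, ← hu, ← hv, hφ₀, hψ₀, hneg, eval_mul, eval_neg]
      ring
    have i : ∀ {f : ℝ → ℝ}, Continuous f → IntervalIntegrable f MeasureTheory.volume 0 1 :=
      fun h => h.intervalIntegrable _ _
    have hsmall : |∫ x in (0 : ℝ)..1, (r.derivative.eval x * ψ₀.eval x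
        - s.derivative.eval x * φ₀.eval x)| ≤ ε * l * (C * N) + ε * l * (C * N) :=
      abs_integral_unit_le fun x hx => (abs_sub _ _).trans (add_le_add
        (abs_mul_le_mul (hr x hx) ((bψ x hx).2.1.trans huN))
        (abs_mul_le_mul (hs x hx) ((bφ x hx).2.1.trans hvN)))
    have hbig : c * N ^ 2 ≤ (∫ x in (0 : ℝ)..1, (bump m).eval x * (polyOf u).eval x ^ 2)
        + ∫ x in (0 : ℝ)..1, (bump m).eval x * (polyOf v).eval x ^ 2 := by
      have lu := low u
      have lv := low v
      have pu : 0 ≤ c * ‖u‖ ^ 2 := by positivity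
      have pv : 0 ≤ c * ‖v‖ ^ 2 := by positivity
      rcases max_choice ‖u‖ ‖v‖ with h | h <;> rw [hN, h] <;> linarith
    rw [hB]
    simp only [e]
    rw [intervalIntegral.integral_add (i (by fun_prop)) (i (by fun_prop)),
      intervalIntegral.integral_add (i (by fun_prop)) (i (by fun_prop))]
    have h1 := (abs_le.1 hsmall).1
    have h2 : ε * l * (C * N) ≤ ε * (2 * C * N) * (C * N) := by
      gcongr; exact hlI.trans hIN
    have h3 : ε * (8 * C ^ 2) * N ^ 2 ≤ c * N ^ 2 := by gcongr
    nlinarith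
  have hκ : |polyArea φ₀ ψ₀| ≤ 2 * (C * N) * (C * N) := by
    refine (abs_integral_unit_le (C := C * N * (C * N) + C * N * (C * N)) fun x hx =>
      (abs_sub _ _).trans (add_le_add
        (abs_mul_le_mul ((bφ x hx).2.2.1.trans hvN) ((bψ x hx).2.1.trans huN))
        (abs_mul_le_mul ((bψ x hx).2.2.1.trans huN) ((bφ x hx).2.1.trans hvN)))).trans ?_
    linarith
  have hE : |A - polyArea (P + r) (Q + s)| ≤ ε * l * (2 * C * N) :=
    hA.trans (by gcongr)
  have hBpos : 0 < B := lt_of_lt_of_le (by positivity) hBlow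
  obtain ⟨t, ht, htb⟩ := exists_quadratic_root_of_small (κ := polyArea φ₀ ψ₀)
    (E := A - polyArea (P + r) (Q + s)) hBpos (by
      calc 4 * |A - polyArea (P + r) (Q + s)| * |polyArea φ₀ ψ₀|
          ≤ 4 * (ε * (2 * C * N) * (2 * C * N)) * (2 * (C * N) * (C * N)) := by
            gcongr
            refine hE.trans ?_
            gcongr
            exact hlI.trans hIN
        _ = ε * (32 * C ^ 4) * N ^ 4 := by ring
        _ ≤ c ^ 2 * N ^ 4 := by gcongr
        _ = (c * N ^ 2) ^ 2 := by ring
        _ ≤ B ^ 2 := by gcongr)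
  have est : ∀ y : ℝ, |y| ≤ C * N → |t * y| ≤ 4 * C ^ 2 / c * ε * l := by
    intro y hy
    refine (abs_mul_le_mul htb hy).trans ?_
    calc 2 * |A - polyArea (P + r) (Q + s)| / B * (C * N)
        ≤ 2 * (ε * l * (2 * C * N)) / (c * N ^ 2) * (C * N) := by gcongr
      _ = 4 * C ^ 2 / c * ε * l := by field_simp; ring
  refine ⟨Polynomial.C t * φ₀, Polynomial.C t * ψ₀, fφ.const_mul t, fψ.const_mul t, ?_, fun x hx => ⟨?_, ?_⟩⟩
  · rw [polyArea_add_flat fφ fψ]; linarith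
  · rw [iterate_derivative_C_mul, eval_mul, eval_C]
    exact est _ ((bφ x hx).2.2.2.trans hvN)
  · rw [iterate_derivative_C_mul, eval_mul, eval_C]
    exact est _ ((bψ x hx).2.2.2.trans huN)

/-- By `area_expand` the hypothesis on `Δ` bounds the deficit of the corrected curve by `4 ε (l² + l
I)`. Whichever of `l` and `I` is larger decides between the quadratic and the linear repair. -/
lemma exists_flat_small {m : ℕ} (hm : 1 ≤ m) {η : ℝ} (hη : 0 < η) : ∃ ε : ℝ, 0 < ε ∧
    ∀ (P Q r s : ℝ[X]) (l Δ : ℝ), P.natDegree ≤ m → Q.natDegree ≤ m → 0 < l →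
    r.eval 0 = 0 → s.eval 0 = 0 →
    (∀ x ∈ Icc (0 : ℝ) 1, |r.eval x| ≤ ε * l ∧ |r.derivative.eval x| ≤ ε * l) →
    (∀ x ∈ Icc (0 : ℝ) 1, |s.eval x| ≤ ε * l ∧ |s.derivative.eval x| ≤ ε * l) →
    |Δ - 2 * polyArea P Q + 2 * P.eval 0 * s.eval 1 - 2 * Q.eval 0 * r.eval 1|
      ≤ ε * (l ^ 2
        + l * ∫ x in (0 : ℝ)..1, (|P.derivative.eval x| + |Q.derivative.eval x|)) →
    ∃ φ ψ : ℝ[X], FlatEnds m φ ∧ FlatEnds m ψ ∧ 2 * polyArea (P + r + φ) (Q + s + ψ) = Δ ∧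
      ∀ x ∈ Icc (0 : ℝ) 1, |(derivative^[m] φ).eval x| ≤ η * l ∧
        |(derivative^[m] ψ).eval x| ≤ η * l := by
  obtain ⟨C₁, hC₁, quad⟩ := exists_flat_quadratic m
  obtain ⟨C₂, ε₀, hC₂, hε₀, lin⟩ := exists_flat_linear hm
  -- The bound `η² / (8 C₁)` serves the regime `I ≤ l`, where the deficit is at most `8 ε l²` and a
  -- square root is taken. The last two serve `l ≤ I`, where the deficit is at most `8 ε l I`.
  set ε := min (min 1 (η ^ 2 / (8 * C₁))) (min (η / (8 * C₂)) (ε₀ / 8)) with hεd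
  have hε : 0 < ε := by positivity
  have e1 : ε ≤ 1 := (min_le_left _ _).trans (min_le_left _ _)
  have e2 : ε * (8 * C₁) ≤ η ^ 2 :=
    (le_div_iff₀ (by positivity)).1 ((min_le_left _ _).trans (min_le_right _ _))
  have e3 : ε * (8 * C₂) ≤ η :=
    (le_div_iff₀ (by positivity)).1 ((min_le_right _ _).trans (min_le_left _ _))
  have e4 : ε ≤ ε₀ / 8 := (min_le_right _ _).trans (min_le_right _ _)
  refine ⟨ε, hε, ?_⟩
  intro P Q r s l Δ hP hQ hl r0 s0 br bs hΔ
  have key := area_expand zero_le_one (p := fun x => P.eval x) (q := fun x => Q.eval x)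
    (r := fun x => r.eval x) (s := fun x => s.eval x)
    (fun x => P.hasDerivAt x) (fun x => Q.hasDerivAt x) (fun x => r.hasDerivAt x)
    (fun x => s.hasDerivAt x) (by fun_prop) (by fun_prop) (by fun_prop) (by fun_prop) r0 s0
    (fun x hx => (br x hx).1) (fun x hx => (bs x hx).1) (fun x hx => (br x hx).2)
    (fun x hx => (bs x hx).2)
  set I := ∫ x in (0 : ℝ)..1, (|P.derivative.eval x| + |Q.derivative.eval x|)
  have hI : 0 ≤ I := intervalIntegral.integral_nonneg zero_le_one fun x _ => by positivity
  have eA : (∫ x in (0 : ℝ)..1, ((P.derivative.eval x + r.derivative.eval x)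
      * (Q.eval x + s.eval x) - (Q.derivative.eval x + s.derivative.eval x)
      * (P.eval x + r.eval x))) = polyArea (P + r) (Q + s) := by simp [polyArea]
  have eB : (∫ x in (0 : ℝ)..1, (P.derivative.eval x * Q.eval x
    - Q.derivative.eval x * P.eval x)) = polyArea P Q := rfl
  rw [eA, eB] at key
  have hE : |Δ / 2 - polyArea (P + r) (Q + s)| ≤ 4 * ε * (l ^ 2 + l * I) := by
    have hlI : 0 ≤ ε * (l * I) := by positivity
    have hl2 : 0 ≤ ε * l ^ 2 := by positivity
    have hl3 : 0 ≤ ε * (1 - ε) * l ^ 2 := by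
      have := sub_nonneg.2 e1; positivity
    rw [abs_le] at *
    constructor <;> nlinarith
  rcases le_total I l with h | h
  · obtain ⟨φ, ψ, fφ, fψ, hA, hb⟩ := quad (P + r) (Q + s) (Δ / 2)
    have hle : C₁ * |Δ / 2 - polyArea (P + r) (Q + s)| ≤ (η * l) ^ 2 := by
      have i1 : l * I ≤ l ^ 2 := by nlinarith
      calc _ ≤ C₁ * (4 * ε * (l ^ 2 + l ^ 2)) := by
            gcongr
            exact hE.trans (by gcongr)
        _ = ε * (8 * C₁) * l ^ 2 := by ring
        _ ≤ η ^ 2 * l ^ 2 := by gcongr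
        _ = _ := by ring
    refine ⟨φ, ψ, fφ, fψ, by linarith, fun x hx => ⟨?_, ?_⟩⟩
    · exact abs_le_of_sq_le_sq ((hb x hx).1.trans hle) (by positivity)
    · exact abs_le_of_sq_le_sq ((hb x hx).2.trans hle) (by positivity)
  · have i0 : ε * l ≤ 8 * ε * l := by nlinarith
    obtain ⟨φ, ψ, fφ, fψ, hA, hb⟩ := lin P Q r s l (8 * ε) (Δ / 2) hP hQ hl (by positivity)
      (by linarith) (fun x hx => (br x hx).2.trans i0) (fun x hx => (bs x hx).2.trans i0) h
      (hE.trans (by nlinarith [mul_nonneg hε.le (mul_nonneg hl.le (sub_nonneg.2 h))]))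
    have i1 : C₂ * (8 * ε) * l ≤ η * l := by
      gcongr; linarith
    exact ⟨φ, ψ, fφ, fψ, by linarith, fun x hx => ⟨(hb x hx).1.trans i1, (hb x hx).2.trans i1⟩⟩

/-! ### Hermite correction and filling a single gap -/

/-- The part of the Hermite interpolation basis that is flat at `0`. -/
lemma exists_hermite_basis (m : ℕ) : ∃ e : ℕ → ℝ[X], ∀ j ≤ m, ∀ k ≤ m,
    (derivative^[k] (e j)).eval 0 = 0 ∧
      (derivative^[k] (e j)).eval 1 = if k = j then 1 else 0 := by
  have hcop : IsCoprime ((X : ℝ[X]) ^ (m + 1)) ((X - C 1) ^ (m + 1)) := by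
    have : IsCoprime (X - C (0 : ℝ)) (X - C 1) := isCoprime_X_sub_C_of_isUnit_sub (by simp)
    rw [C_0, sub_zero] at this
    exact this.pow
  obtain ⟨u, v, huv⟩ := hcop
  -- By the Bézout identity `u X^(m+1)` is divisible by `X^(m+1)` and congruent to `1` modulo `(X -
  -- 1)^(m+1)`, so multiplying by it makes `(X - 1)^j / j!` flat at `0` without changing its jet at
  -- `1`.
  refine ⟨fun j => u * X ^ (m + 1) * (C (1 / (j.factorial : ℝ)) * (X - C 1) ^ j), fun j hj k hk =>
    ⟨iterate_derivative_eval_eq_zero ?_ hk, ?_⟩⟩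
  · rw [C_0, sub_zero]
    exact (dvd_mul_left _ _).mul_right _
  · have e : u * X ^ (m + 1) * (C (1 / (j.factorial : ℝ)) * (X - C 1) ^ j)
        = C (1 / (j.factorial : ℝ)) * (X - C 1) ^ j
          - (X - C 1) ^ (m + 1) * (v * (C (1 / (j.factorial : ℝ)) * (X - C 1) ^ j)) := by
      linear_combination (C (1 / (j.factorial : ℝ)) * (X - C 1) ^ j) * huv
    beta_reduce
    rw [e, iterate_derivative_sub, eval_sub,
      iterate_derivative_eval_eq_zero (dvd_mul_right _ _) hk, sub_zero,
      iterate_derivative_C_mul, iterate_derivative_X_sub_pow]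
    simp only [eval_mul, eval_C, nsmul_eq_mul, eval_natCast, eval_pow, eval_sub, eval_X, sub_self]
    rcases lt_trichotomy k j with h | h | h
    · rw [zero_pow (by omega), if_neg h.ne]; ring
    · subst h
      have : (k.factorial : ℝ) ≠ 0 := by positivity
      rw [Nat.descFactorial_self, if_pos rfl, Nat.sub_self, pow_zero]
      field_simp
    · rw [Nat.descFactorial_of_lt h, if_neg h.ne']; simp

lemma iterate_derivative_comp_affine (p : ℝ[X]) (c d : ℝ) (k : ℕ) :
    derivative^[k] (p.comp (C c * X + C d))
      = C (c ^ k) * (derivative^[k] p).comp (C c * X + C d) := by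
  induction k with
  | zero => simp
  | succ k ih =>
    rw [Function.iterate_succ_apply', ih, Function.iterate_succ_apply', derivative_C_mul,
      derivative_comp]
    simp only [derivative_add, derivative_C_mul, derivative_X, derivative_C, C_pow]
    ring

lemma eval_iterate_derivative_comp_affine (p : ℝ[X]) (c d : ℝ) (k : ℕ) (x : ℝ) :
    (derivative^[k] (p.comp (C c * X + C d))).eval x
      = c ^ k * (derivative^[k] p).eval (c * x + d) := by
  simp [iterate_derivative_comp_affine]

lemma eval_derivative_comp_affine (p : ℝ[X]) (c d x : ℝ) :
    (p.comp (C c * X + C d)).derivative.eval x = c * p.derivative.eval (c * x + d) := by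
  simpa using eval_iterate_derivative_comp_affine p c d 1 x

lemma polyArea_comp_affine (p q : ℝ[X]) (a b : ℝ) :
    polyArea (p.comp (C (b - a) * X + C a)) (q.comp (C (b - a) * X + C a))
      = ∫ x in a..b, (p.derivative.eval x * q.eval x - q.derivative.eval x * p.eval x) := by
  have := intervalIntegral.mul_integral_comp_mul_add (a := 0) (b := 1)
    (f := fun x => p.derivative.eval x * q.eval x - q.derivative.eval x * p.eval x) (b - a) a
  rw [mul_zero, zero_add, mul_one, sub_add_cancel] at this
  rw [← this, ← intervalIntegral.integral_const_mul, polyArea]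
  congr 1; ext x
  simp only [eval_derivative_comp_affine]
  simp; ring

lemma integral_speed_comp_affine (p q : ℝ[X]) {a b : ℝ} (hab : a ≤ b) :
    (∫ x in (0 : ℝ)..1, (|(p.comp (C (b - a) * X + C a)).derivative.eval x|
      + |(q.comp (C (b - a) * X + C a)).derivative.eval x|))
      = ∫ x in a..b, (|p.derivative.eval x| + |q.derivative.eval x|) := by
  have := intervalIntegral.mul_integral_comp_mul_add (a := 0) (b := 1)
    (f := fun x => |p.derivative.eval x| + |q.derivative.eval x|) (b - a) a
  rw [mul_zero, zero_add, mul_one, sub_add_cancel] at this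
  rw [← this, ← intervalIntegral.integral_const_mul]
  congr 1; ext x
  simp only [eval_derivative_comp_affine, abs_mul, abs_of_nonneg (sub_nonneg.2 hab)]
  ring

/-- `Φ` and `Ψ` interpolate the jets `F` and `G` at `a` and `b`, the area they sweep lifts to the
height difference `Δ`, and their top derivatives stay within `c` of those at `a`. -/
def GapFill (m : ℕ) (F G : ℕ → ℝ → ℝ) (Δ a b : ℝ) (Φ Ψ : ℝ[X]) (c : ℝ) : Prop :=
  (∀ k ≤ m, (derivative^[k] Φ).eval a = F k a ∧ (derivative^[k] Φ).eval b = F k b) ∧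
  (∀ k ≤ m, (derivative^[k] Ψ).eval a = G k a ∧ (derivative^[k] Ψ).eval b = G k b) ∧
  2 * (∫ x in a..b, (Φ.derivative.eval x * Ψ.eval x - Ψ.derivative.eval x * Φ.eval x)) = Δ ∧
  ∀ x ∈ Icc a b, |(derivative^[m] Φ).eval x - F m a| ≤ c ∧ |(derivative^[m] Ψ).eval x - G m a| ≤ c

/-- The rescaled Hermite correction of the Taylor polynomial at `a` towards the jet at `b`. -/
noncomputable def corrector (e : ℕ → ℝ[X]) (m : ℕ) (F : ℕ → ℝ → ℝ) (a b : ℝ) : ℝ[X] :=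
  ∑ j ∈ Finset.range (m + 1), C ((b - a) ^ j * remainder m F a j b) * e j

lemma corrector_eval {e : ℕ → ℝ[X]} {m k : ℕ} (hk : k ≤ m) (he : ∀ j ≤ m, ∀ k ≤ m,
    (derivative^[k] (e j)).eval 0 = 0 ∧ (derivative^[k] (e j)).eval 1 = if k = j then 1 else 0)
    (F : ℕ → ℝ → ℝ) (a b : ℝ) :
    (derivative^[k] (corrector e m F a b)).eval 0 = 0 ∧
      (derivative^[k] (corrector e m F a b)).eval 1 = (b - a) ^ k * remainder m F a k b := by
  simp only [corrector, iterate_derivative_sum, iterate_derivative_C_mul, eval_finsetSum, eval_mul,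
    eval_C]
  constructor
  · refine Finset.sum_eq_zero fun j hj => ?_
    rw [Finset.mem_range] at hj
    rw [(he j (by omega) k hk).1, mul_zero]
  · rw [Finset.sum_eq_single k]
    · rw [(he k hk k hk).2, if_pos rfl, mul_one]
    · intro j hj hjk
      rw [Finset.mem_range] at hj
      rw [(he j (by omega) k hk).2, if_neg hjk.symm, mul_zero]
    · intro h
      exact absurd (Finset.mem_range.2 (by omega)) h

lemma exists_corrector_bound (e : ℕ → ℝ[X]) (m k : ℕ) : ∃ D : ℝ, 0 < D ∧
    ∀ (F : ℕ → ℝ → ℝ) (a b ε : ℝ), a < b → 0 ≤ ε →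
      (∀ j ≤ m, |remainder m F a j b| ≤ ε * (b - a) ^ (m - j)) →
      ∀ x ∈ Icc (0 : ℝ) 1,
        |(derivative^[k] (corrector e m F a b)).eval x| ≤ D * (ε * (b - a) ^ m) := by
  choose B hB bB using fun j => exists_bound_unit (derivative^[k] (e j))
  refine ⟨∑ j ∈ Finset.range (m + 1), B j, Finset.sum_pos (fun j _ => hB j) (by simp), ?_⟩
  intro F a b ε hab hε h x hx
  have hL : 0 < b - a := sub_pos.2 hab
  simp only [corrector, iterate_derivative_sum, iterate_derivative_C_mul, eval_finsetSum, eval_mul,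
    eval_C, Finset.sum_mul]
  refine (Finset.abs_sum_le_sum_abs _ _).trans (Finset.sum_le_sum fun j hj => ?_)
  rw [Finset.mem_range] at hj
  rw [mul_comm (B j)]
  refine abs_mul_le_mul ?_ (bB j x hx)
  rw [abs_mul, abs_of_nonneg (by positivity)]
  calc (b - a) ^ j * |remainder m F a j b| ≤ (b - a) ^ j * (ε * (b - a) ^ (m - j)) := by
        gcongr; exact h j (by omega)
    _ = ε * ((b - a) ^ j * (b - a) ^ (m - j)) := by ring
    _ = _ := by rw [← pow_add, Nat.add_sub_cancel' (by omega)]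

/-- The polynomial on `[a, b]` whose rescaling to the unit interval is the rescaled Taylor
polynomial plus the correction `u`. -/
noncomputable def fillPoly (m : ℕ) (F : ℕ → ℝ → ℝ) (a b : ℝ) (u : ℝ[X]) : ℝ[X] :=
  taylorPoly m F a + u.comp (C (b - a)⁻¹ * X + C (-(b - a)⁻¹ * a))

lemma fillPoly_comp {m : ℕ} {F : ℕ → ℝ → ℝ} {a b : ℝ} (hab : a < b) (u : ℝ[X]) :
    (fillPoly m F a b u).comp (C (b - a) * X + C a)
      = (taylorPoly m F a).comp (C (b - a) * X + C a) + u := by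
  have hL : b - a ≠ 0 := (sub_pos.2 hab).ne'
  rw [fillPoly, add_comp, comp_assoc]
  congr 1
  have : (C (b - a)⁻¹ * X + C (-(b - a)⁻¹ * a)).comp (C (b - a) * X + C a) = (X : ℝ[X]) := by
    simp only [add_comp, mul_comp, C_comp, X_comp, mul_add, ← mul_assoc, ← C_mul,
      inv_mul_cancel₀ hL, C_1, one_mul, add_assoc, ← C_add]
    rw [show (b - a)⁻¹ * a + -(b - a)⁻¹ * a = 0 by ring, C_0, add_zero]
  rw [this, comp_X]

lemma fillPoly_eval {m k : ℕ} (F : ℕ → ℝ → ℝ) {a b : ℝ} (u : ℝ[X]) (x : ℝ) :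
    (derivative^[k] (fillPoly m F a b u)).eval x = (derivative^[k] (taylorPoly m F a)).eval x
      + ((b - a) ^ k)⁻¹ * (derivative^[k] u).eval ((x - a) / (b - a)) := by
  rw [fillPoly, iterate_map_add, eval_add, eval_iterate_derivative_comp_affine, inv_pow]
  congr 4
  ring

lemma fillPoly_jet {e : ℕ → ℝ[X]} {m : ℕ} (he : ∀ j ≤ m, ∀ k ≤ m,
    (derivative^[k] (e j)).eval 0 = 0 ∧ (derivative^[k] (e j)).eval 1 = if k = j then 1 else 0)
    (F : ℕ → ℝ → ℝ) {a b : ℝ} (hab : a < b) {φ : ℝ[X]} (hφ : FlatEnds m φ) {k : ℕ} (hk : k ≤ m) :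
    (derivative^[k] (fillPoly m F a b (corrector e m F a b + φ))).eval a = F k a ∧
      (derivative^[k] (fillPoly m F a b (corrector e m F a b + φ))).eval b = F k b := by
  have hL : b - a ≠ 0 := (sub_pos.2 hab).ne'
  rw [fillPoly_eval, fillPoly_eval, sub_self, zero_div, div_self hL, iterate_map_add,
    eval_add, eval_add, (hφ k hk).1, (hφ k hk).2, (corrector_eval hk he F a b).1,
    (corrector_eval hk he F a b).2, taylorPoly_iterate_derivative_eval_self hk, remainder_eq hk]
  refine ⟨by simp, ?_⟩
  have : (b - a) ^ k ≠ 0 := pow_ne_zero _ hL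
  field_simp
  ring

lemma fillPoly_top (m : ℕ) (F : ℕ → ℝ → ℝ) {a b c : ℝ} (hab : a < b) {u : ℝ[X]}
    (hu : ∀ x ∈ Icc (0 : ℝ) 1, |(derivative^[m] u).eval x| ≤ c * (b - a) ^ m) :
    ∀ x ∈ Icc a b, |(derivative^[m] (fillPoly m F a b u)).eval x - F m a| ≤ c := by
  intro x hx
  have hL : 0 < b - a := sub_pos.2 hab
  rw [fillPoly_eval, taylorPoly_iterate_derivative_top, add_sub_cancel_left, abs_mul, abs_inv,
    abs_of_pos (pow_pos hL m), inv_mul_le_iff₀ (pow_pos hL m), mul_comm]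
  refine hu _ ⟨div_nonneg (by linarith [hx.1]) hL.le, (div_le_one hL).2 (by linarith [hx.2])⟩

lemma gapFill_fillPoly {e : ℕ → ℝ[X]} {m : ℕ} (he : ∀ j ≤ m, ∀ k ≤ m,
    (derivative^[k] (e j)).eval 0 = 0 ∧ (derivative^[k] (e j)).eval 1 = if k = j then 1 else 0)
    (F G : ℕ → ℝ → ℝ) {Δ a b c : ℝ} (hab : a < b) {φ ψ : ℝ[X]} (hφ : FlatEnds m φ)
    (hψ : FlatEnds m ψ)
    (hA : 2 * polyArea ((taylorPoly m F a).comp (C (b - a) * X + C a) + (corrector e m F a b + φ))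
      ((taylorPoly m G a).comp (C (b - a) * X + C a) + (corrector e m G a b + ψ)) = Δ)
    (bφ : ∀ x ∈ Icc (0 : ℝ) 1,
      |(derivative^[m] (corrector e m F a b + φ)).eval x| ≤ c * (b - a) ^ m)
    (bψ : ∀ x ∈ Icc (0 : ℝ) 1,
      |(derivative^[m] (corrector e m G a b + ψ)).eval x| ≤ c * (b - a) ^ m) :
    GapFill m F G Δ a b (fillPoly m F a b (corrector e m F a b + φ))
      (fillPoly m G a b (corrector e m G a b + ψ)) c := by
  refine ⟨fun k hk => fillPoly_jet he F hab hφ hk, fun k hk => fillPoly_jet he G hab hψ hk, ?_,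
    fun x hx => ⟨fillPoly_top m F hab bφ x hx, fillPoly_top m G hab bψ x hx⟩⟩
  rw [← polyArea_comp_affine, fillPoly_comp hab, fillPoly_comp hab, hA]

/-- No closeness is claimed: this serves the gaps that are not short. -/
lemma exists_gapFill (m : ℕ) (F G : ℕ → ℝ → ℝ) (Δ : ℝ) {a b : ℝ} (hab : a < b) :
    ∃ (Φ Ψ : ℝ[X]) (c : ℝ), 0 ≤ c ∧ GapFill m F G Δ a b Φ Ψ c := by
  obtain ⟨e, he⟩ := exists_hermite_basis m
  obtain ⟨C₀, -, quad⟩ := exists_flat_quadratic m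
  obtain ⟨φ, ψ, hφ, hψ, hA, -⟩ := quad
    ((taylorPoly m F a).comp (C (b - a) * X + C a) + corrector e m F a b)
    ((taylorPoly m G a).comp (C (b - a) * X + C a) + corrector e m G a b) (Δ / 2)
  obtain ⟨D₁, h₁, b₁⟩ := exists_bound_unit (derivative^[m] (corrector e m F a b + φ))
  obtain ⟨D₂, h₂, b₂⟩ := exists_bound_unit (derivative^[m] (corrector e m G a b + ψ))
  have hL : 0 < (b - a) ^ m := pow_pos (sub_pos.2 hab) m
  have hc : (D₁ + D₂) / (b - a) ^ m * (b - a) ^ m = D₁ + D₂ := by field_simp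
  refine ⟨_, _, (D₁ + D₂) / (b - a) ^ m, by positivity, gapFill_fillPoly he F G hab hφ hψ ?_
    (fun x hx => ?_) fun x hx => ?_⟩
  · rw [← add_assoc, ← add_assoc, hA]; ring
  · rw [hc]; linarith [b₁ x hx]
  · rw [hc]; linarith [b₂ x hx]

/-- After rescaling, the velocity becomes `l² + l I` and the discrepancy is exactly the quantity
controlled in `exists_flat_small`. The budget `η` is split evenly between the Hermite correction and
the flat repair. -/
lemma exists_gapFill_small {m : ℕ} (hm : 1 ≤ m) {K : Set ℝ} {F G H : ℕ → ℝ → ℝ}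
    (hF : IsWhitneyField m K F) (hG : IsWhitneyField m K G)
    (hA : ∀ ε : ℝ, 0 < ε → ∃ δ : ℝ, 0 < δ ∧ ∀ a ∈ K, ∀ b ∈ K, a < b → b - a < δ →
      |areaDiscrepancy m F G H a b / velocity m F G a b| < ε) {η : ℝ} (hη : 0 < η) :
    ∃ δ : ℝ, 0 < δ ∧ ∀ a ∈ K, ∀ b ∈ K, a < b → b - a < δ →
      ∃ Φ Ψ : ℝ[X], GapFill m F G (H 0 b - H 0 a) a b Φ Ψ η := by
  obtain ⟨e, he⟩ := exists_hermite_basis m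
  obtain ⟨ε, hε, small⟩ := exists_flat_small hm (half_pos hη)
  choose D hD bD using fun k => exists_corrector_bound e m k
  set M := D 0 + D 1 + D m with hM
  have hM0 : 0 < M := by have := hD 0; have := hD 1; have := hD m; positivity
  set ε' := min (ε / M) (η / (2 * M)) with hε'
  have hε'0 : 0 < ε' := by positivity
  have i1 : ε' * M ≤ ε := (le_div_iff₀ hM0).1 (min_le_left _ _)
  have i2 : ε' * (2 * M) ≤ η := (le_div_iff₀ (by positivity)).1 (min_le_right _ _)
  have unif : ∀ {F : ℕ → ℝ → ℝ}, IsWhitneyField m K F → ∃ δ : ℝ, 0 < δ ∧ ∀ a ∈ K, ∀ b ∈ K,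
      a < b → b - a < δ → ∀ j ≤ m, |remainder m F a j b| ≤ ε' * (b - a) ^ (m - j) := by
    intro F hF
    choose! d hd Hd using fun j (hj : j ≤ m) => hF j hj ε' hε'0
    refine ⟨(Finset.range (m + 1)).inf' (by simp) d, ?_, fun a ha b hb hab hlt j hj => ?_⟩
    · rw [Finset.lt_inf'_iff]
      intro j hj
      rw [Finset.mem_range] at hj
      exact hd j (by omega)
    · have e1 : |a - b| = b - a := by rw [abs_sub_comm, abs_of_pos (sub_pos.2 hab)]
      have := Hd j hj a ha b hb (by
        rw [e1]
        exact hlt.trans_le (Finset.inf'_le _ (Finset.mem_range.2 (by omega))))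
      rwa [e1] at this
  obtain ⟨δ₁, hδ₁, w₁⟩ := unif hF
  obtain ⟨δ₂, hδ₂, w₂⟩ := unif hG
  obtain ⟨δ₃, hδ₃, w₃⟩ := hA ε hε
  refine ⟨min δ₁ (min δ₂ δ₃), by positivity, fun a ha b hb hab hlt => ?_⟩
  have v₁ := w₁ a ha b hb hab (hlt.trans_le (min_le_left _ _))
  have v₂ := w₂ a ha b hb hab (hlt.trans_le ((min_le_right _ _).trans (min_le_left _ _)))
  have v₃ := w₃ a ha b hb hab (hlt.trans_le ((min_le_right _ _).trans (min_le_right _ _)))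
  have hL : 0 < (b - a) ^ m := pow_pos (sub_pos.2 hab) m
  set l := (b - a) ^ m with hl
  have hV := velocity_pos (m := m) F G hab
  rw [abs_div, abs_of_pos hV, div_lt_iff₀ hV] at v₃
  have cb : ∀ {F : ℕ → ℝ → ℝ}, (∀ j ≤ m, |remainder m F a j b| ≤ ε' * (b - a) ^ (m - j)) →
      ∀ k, D k ≤ M → ∀ x ∈ Icc (0 : ℝ) 1,
        |(derivative^[k] (corrector e m F a b)).eval x| ≤ ε' * M * l := by
    intro F hF k hk x hx
    refine (bD k F a b ε' hab hε'0.le hF x hx).trans ?_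
    calc D k * (ε' * l) ≤ M * (ε' * l) := by gcongr
      _ = _ := by ring
  have h0 : D 0 ≤ M := by linarith [hD 1, hD m]
  have h1 : D 1 ≤ M := by linarith [hD 0, hD m]
  have h2 : D m ≤ M := by linarith [hD 0, hD 1]
  have hcl : ε' * M * l ≤ ε * l := by gcongr
  have deg : ∀ F : ℕ → ℝ → ℝ,
      ((taylorPoly m F a).comp (C (b - a) * X + C a)).natDegree ≤ m := by
    intro F
    refine natDegree_comp_le.trans ?_
    have d1 : (taylorPoly m F a).natDegree ≤ m := by
      refine natDegree_sum_le_of_forall_le _ _ fun j hj => ?_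
      rw [Finset.mem_range] at hj
      refine (natDegree_C_mul_le _ _).trans ((natDegree_pow_le).trans ?_)
      rw [natDegree_X_sub_C]; omega
    have d2 : (C (b - a) * X + C a : ℝ[X]).natDegree ≤ 1 := natDegree_linear_le
    nlinarith
  have z0 : ∀ F : ℕ → ℝ → ℝ, (corrector e m F a b).eval 0 = 0 := fun F =>
    (corrector_eval (Nat.zero_le m) he F a b).1
  have z1 : ∀ F : ℕ → ℝ → ℝ, (corrector e m F a b).eval 1
      = F 0 b - (taylorPoly m F a).eval b := by
    intro F
    have := (corrector_eval (Nat.zero_le m) he F a b).2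
    rw [pow_zero, one_mul, remainder_eq (Nat.zero_le m)] at this
    exact this
  have t0 : ∀ F : ℕ → ℝ → ℝ,
      ((taylorPoly m F a).comp (C (b - a) * X + C a)).eval 0 = F 0 a := by
    intro F
    simpa using taylorPoly_iterate_derivative_eval_self (Nat.zero_le m) F a
  obtain ⟨φ, ψ, hφ, hψ, hArea, bd⟩ := small
    ((taylorPoly m F a).comp (C (b - a) * X + C a))
    ((taylorPoly m G a).comp (C (b - a) * X + C a))
    (corrector e m F a b) (corrector e m G a b) l (H 0 b - H 0 a) (deg F) (deg G) hL (z0 F) (z0 G)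
    (fun x hx => ⟨(cb v₁ 0 h0 x hx).trans hcl, (cb v₁ 1 h1 x hx).trans hcl⟩)
    (fun x hx => ⟨(cb v₂ 0 h0 x hx).trans hcl, (cb v₂ 1 h1 x hx).trans hcl⟩)
    (by
      rw [polyArea_comp_affine, integral_speed_comp_affine _ _ hab.le, t0, t0, z1, z1, hl, ← pow_mul,
        mul_comm m 2]
      exact v₃.le)
  refine ⟨_, _, gapFill_fillPoly he F G hab hφ hψ (by rw [← add_assoc, ← add_assoc, hArea])
    (fun x hx => ?_) fun x hx => ?_⟩
  · rw [iterate_map_add, eval_add]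
    refine (abs_add_le _ _).trans ((add_le_add (cb v₁ m h2 x hx) (bd x hx).1).trans ?_)
    nlinarith
  · rw [iterate_map_add, eval_add]
    refine (abs_add_le _ _).trans ((add_le_add (cb v₂ m h2 x hx) (bd x hx).2).trans ?_)
    nlinarith

/-- Fillings of all gaps of `K` can be chosen at once so that short gaps have small oscillation. -/
lemma exists_gapFill_family {m : ℕ} (hm : 1 ≤ m) {K : Set ℝ} {F G H : ℕ → ℝ → ℝ}
    (hF : IsWhitneyField m K F) (hG : IsWhitneyField m K G)
    (hA : ∀ ε : ℝ, 0 < ε → ∃ δ : ℝ, 0 < δ ∧ ∀ a ∈ K, ∀ b ∈ K, a < b → b - a < δ →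
      |areaDiscrepancy m F G H a b / velocity m F G a b| < ε) :
    ∃ (Φ Ψ : ℝ → ℝ → ℝ[X]) (c : ℝ → ℝ → ℝ),
      (∀ a b, a < b → GapFill m F G (H 0 b - H 0 a) a b (Φ a b) (Ψ a b) (c a b)) ∧
      ∀ η : ℝ, 0 < η → ∃ δ : ℝ, 0 < δ ∧ ∀ a ∈ K, ∀ b ∈ K, a < b → b - a < δ → c a b ≤ η := by
  have step : ∀ a b : ℝ, ∃ (Φ Ψ : ℝ[X]) (c : ℝ), a < b →
      GapFill m F G (H 0 b - H 0 a) a b Φ Ψ c ∧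
      ∀ Φ' Ψ' c', 0 ≤ c' → GapFill m F G (H 0 b - H 0 a) a b Φ' Ψ' c' → c ≤ c' + (b - a) := by
    intro a b
    by_cases hab : a < b
    · set S : Set ℝ := {c | 0 ≤ c ∧ ∃ Φ Ψ : ℝ[X], GapFill m F G (H 0 b - H 0 a) a b Φ Ψ c}
      have hne : S.Nonempty := by
        obtain ⟨Φ, Ψ, c, hc, h⟩ := exists_gapFill m F G (H 0 b - H 0 a) hab
        exact ⟨c, hc, Φ, Ψ, h⟩
      -- One filling per pair must serve every `η`. It is chosen optimal up to the error `b - a`,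
      -- which is itself small on short gaps.
      obtain ⟨c, ⟨-, Φ, Ψ, h⟩, hlt⟩ := exists_lt_of_csInf_lt hne
        (lt_add_of_pos_right (sInf S) (sub_pos.2 hab))
      refine ⟨Φ, Ψ, c, fun _ => ⟨h, fun Φ' Ψ' c' hc' h' => ?_⟩⟩
      have : sInf S ≤ c' := csInf_le ⟨0, fun y hy => hy.1⟩ ⟨hc', Φ', Ψ', h'⟩
      linarith
    · exact ⟨0, 0, 0, fun h => absurd h hab⟩
  choose Φ Ψ c h using step
  refine ⟨Φ, Ψ, c, fun a b hab => (h a b hab).1, fun η hη => ?_⟩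
  obtain ⟨δ, hδ, hs⟩ := exists_gapFill_small hm hF hG hA (half_pos hη)
  refine ⟨min δ (η / 2), by positivity, fun a ha b hb hab hlt => ?_⟩
  obtain ⟨Φ', Ψ', h'⟩ := hs a ha b hb hab (hlt.trans_le (min_le_left _ _))
  have := (h a b hab).2 Φ' Ψ' _ (half_pos hη).le h'
  linarith [hlt.trans_le (min_le_right δ (η / 2))]

/-! ### Gluing across the gaps of a compact set -/

/-- `(a, b)` is a bounded component of the complement of `K`. -/
def IsGap (K : Set ℝ) (a b : ℝ) : Prop :=
  a ∈ K ∧ b ∈ K ∧ a < b ∧ ∀ x ∈ Ioo a b, x ∉ K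

/-- If no point of `K` lies within `δ` to the right of `x`, the first point of `K` beyond that
distance closes a gap that starts at `x`. -/
lemma exists_near_or_gap_right {K : Set ℝ} (hK : IsCompact K) {x y δ : ℝ} (hx : x ∈ K) (hy : y ∈ K)
    (hxy : x < y) (hδ : 0 < δ) :
    (∃ z ∈ K, x < z ∧ z < x + δ ∧ z ≤ y) ∨ ∃ b ≤ y, IsGap K x b := by
  by_cases h : ∃ z ∈ K, x < z ∧ z < x + δ ∧ z ≤ y
  · exact Or.inl h
  · push Not at h
    obtain ⟨b, ⟨hbK, hb⟩, hmin⟩ := (hK.inter_right (isClosed_Icc (a := min (x + δ) y)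
      (b := y))).exists_isLeast ⟨y, hy, min_le_right _ _, le_rfl⟩
    refine Or.inr ⟨b, hb.2, hx, hbK, lt_of_lt_of_le (lt_min (by linarith) hxy) hb.1, ?_⟩
    intro z hz hzK
    rcases lt_or_ge z (x + δ) with h1 | h1
    · exact absurd (hz.2.le.trans hb.2) (not_le.2 (h z hzK hz.1 h1))
    · exact absurd (hmin ⟨hzK, (min_le_left _ _).trans h1, hz.2.le.trans hb.2⟩) (not_le.2 hz.2)

lemma exists_near_or_gap_left {K : Set ℝ} (hK : IsCompact K) {x y δ : ℝ} (hx : x ∈ K) (hy : y ∈ K)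
    (hxy : y < x) (hδ : 0 < δ) :
    (∃ z ∈ K, z < x ∧ x - δ < z ∧ y ≤ z) ∨ ∃ a, y ≤ a ∧ IsGap K a x := by
  by_cases h : ∃ z ∈ K, z < x ∧ x - δ < z ∧ y ≤ z
  · exact Or.inl h
  · push Not at h
    obtain ⟨a, ⟨haK, ha⟩, hmax⟩ := (hK.inter_right (isClosed_Icc (a := y)
      (b := max (x - δ) y))).exists_isGreatest ⟨y, hy, le_rfl, le_max_right _ _⟩
    refine Or.inr ⟨a, ha.1, haK, hx, lt_of_le_of_lt ha.2 (max_lt (by linarith) hxy), ?_⟩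
    intro z hz hzK
    rcases lt_or_ge (x - δ) z with h1 | h1
    · exact absurd (ha.1.trans hz.1.le) (not_le.2 (h z hzK hz.2 h1))
    · exact absurd (hmax ⟨hzK, ha.1.trans hz.1.le, h1.trans (le_max_left _ _)⟩) (not_le.2 hz.1)

/-- A function on `K` with zero derivative along `K` and equal values at the ends of every gap is
constant. -/
lemma eq_of_hasDerivWithinAt_zero {K : Set ℝ} (hK : IsCompact K) {D : ℝ → ℝ}
    (hD : ∀ x ∈ K, HasDerivWithinAt D 0 K x) (hgap : ∀ a b, IsGap K a b → D b = D a)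
    {x y : ℝ} (hx : x ∈ K) (hy : y ∈ K) (hxy : x ≤ y) : D y = D x := by
  have key : ∀ ε : ℝ, 0 < ε → |D y - D x| ≤ ε * (y - x) := by
    intro ε hε
    have cD : ContinuousOn D K := fun z hz => (hD z hz).continuousWithinAt
    have hKI : IsCompact (K ∩ Icc x y) := hK.inter_right isClosed_Icc
    have hS : IsCompact (K ∩ Icc x y ∩ (fun z => |D z - D x| - ε * (z - x)) ⁻¹' Iic 0) := by
      refine hKI.of_isClosed_subset (ContinuousOn.preimage_isClosed_of_isClosed ?_ hKI.isClosed
        isClosed_Iic) inter_subset_left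
      have := cD.mono (inter_subset_left (t := Icc x y))
      fun_prop
    -- The last point `s` of `K` where the estimate holds must be `y`: otherwise it passes to a
    -- nearby point of `K`, by the zero derivative, or across a gap starting at `s`.
    obtain ⟨s, ⟨⟨hsK, hs⟩, hsε⟩, hmax⟩ := hS.exists_isGreatest
      ⟨x, ⟨hx, le_rfl, hxy⟩, by simp⟩
    have hsε' : |D s - D x| ≤ ε * (s - x) := sub_nonpos.1 hsε
    rcases hs.2.eq_or_lt with rfl | hlt
    · exact hsε'
    exfalso
    have extend : ∀ z ∈ K, s < z → z ≤ y → |D z - D s| ≤ ε * (z - s) → False := by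
      intro z hzK hsz hzy hz
      refine absurd (hmax ⟨⟨hzK, hs.1.trans hsz.le, hzy⟩, ?_⟩) (not_le.2 hsz)
      have := abs_add_le (D z - D s) (D s - D x)
      rw [sub_add_sub_cancel] at this
      simp only [mem_preimage, mem_Iic]
      linarith
    have hev := (hasDerivWithinAt_iff_isLittleO.1 (hD s hsK)).def hε
    obtain ⟨δ, hδ, hball⟩ := Metric.mem_nhdsWithin_iff.1 hev
    rcases exists_near_or_gap_right hK hsK hy hlt hδ with ⟨z, hzK, hsz, hzδ, hzy⟩ | ⟨b, hby, hb⟩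
    · have h1 : z ∈ Metric.ball s δ ∩ K := by
        refine ⟨?_, hzK⟩
        rw [Metric.mem_ball, Real.dist_eq, abs_of_pos (sub_pos.2 hsz)]; linarith
      have := hball h1
      simp only [mem_ofPred_eq, smul_zero, sub_zero, Real.norm_eq_abs] at this
      rw [abs_of_pos (sub_pos.2 hsz)] at this
      exact extend z hzK hsz hzy this
    · refine extend b hb.2.1 hb.2.2.1 hby ?_
      rw [hgap s b hb, sub_self, abs_zero]
      exact mul_nonneg hε.le (sub_nonneg.2 hb.2.2.1.le)
  by_contra hne
  have hpos : 0 < |D y - D x| := abs_pos.2 (sub_ne_zero.2 hne)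
  have h1 : 0 < y - x + 1 := by linarith
  have := key (|D y - D x| / (2 * (y - x + 1))) (by positivity)
  rw [div_mul_eq_mul_div, le_div_iff₀ (by positivity)] at this
  nlinarith

lemma exists_iterated_antiderivative (m : ℕ) {φ : ℝ → ℝ} (hφ : Continuous φ) (c : ℝ) (v : ℕ → ℝ) :
    ∃ f : ℝ → ℝ, ContDiff ℝ m f ∧ iteratedDeriv m f = φ ∧ ∀ k < m, iteratedDeriv k f c = v k := by
  induction m generalizing v with
  | zero => exact ⟨φ, contDiff_zero.2 hφ, iteratedDeriv_zero, fun k hk => absurd hk (by omega)⟩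
  | succ m ih =>
    obtain ⟨f, hf, hfm, hfk⟩ := ih fun k => v (k + 1)
    have hd : ∀ x, HasDerivAt (fun x => v 0 + ∫ t in c..x, f t) (f x) x := fun x =>
      (hf.continuous.integral_hasStrictDerivAt c x).hasDerivAt.const_add (v 0)
    have hd' : deriv (fun x => v 0 + ∫ t in c..x, f t) = f := funext fun x => (hd x).deriv
    refine ⟨fun x => v 0 + ∫ t in c..x, f t, ?_, ?_, fun k hk => ?_⟩
    · rw [Nat.cast_succ, contDiff_succ_iff_deriv, hd']
      exact ⟨fun x => (hd x).differentiableAt, by simp, hf⟩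
    · rw [iteratedDeriv_succ', hd', hfm]
    · rcases k with _ | k
      · simp
      · rw [iteratedDeriv_succ', hd', hfk k (by omega)]

lemma IsGap.eq_of_mem {K : Set ℝ} {a b a' b' x : ℝ} (h : IsGap K a b) (h' : IsGap K a' b')
    (hx : x ∈ Ioo a b) (hx' : x ∈ Ioo a' b') : a = a' ∧ b = b' := by
  obtain ⟨ha, hb, -, hn⟩ := h
  obtain ⟨ha', hb', -, hn'⟩ := h'
  constructor
  · rcases lt_trichotomy a a' with h | h | h
    · exact absurd ha' (hn a' ⟨h, hx'.1.trans hx.2⟩)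
    · exact h
    · exact absurd ha (hn' a ⟨h, hx.1.trans hx'.2⟩)
  · rcases lt_trichotomy b b' with h | h | h
    · exact absurd hb (hn' b ⟨hx'.1.trans hx.2, h⟩)
    · exact h
    · exact absurd hb' (hn b' ⟨hx.1.trans hx'.2, h⟩)

lemma exists_gap_of_notMem {K : Set ℝ} (hK : IsCompact K) {c d x : ℝ} (hc : c ∈ K) (hd : d ∈ K)
    (hx : x ∈ Icc c d) (hxK : x ∉ K) : ∃ a b, IsGap K a b ∧ x ∈ Ioo a b := by
  obtain ⟨a, ⟨haK, ha⟩, hmax⟩ := (hK.inter_right (isClosed_Icc (a := c)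
    (b := x))).exists_isGreatest ⟨c, hc, le_rfl, hx.1⟩
  obtain ⟨b, ⟨hbK, hb⟩, hmin⟩ := (hK.inter_right (isClosed_Icc (a := x)
    (b := d))).exists_isLeast ⟨d, hd, hx.2, le_rfl⟩
  have hax : a < x := lt_of_le_of_ne ha.2 (by rintro rfl; exact hxK haK)
  have hxb : x < b := lt_of_le_of_ne hb.1 (by rintro rfl; exact hxK hbK)
  refine ⟨a, b, ⟨haK, hbK, hax.trans hxb, fun z hz hzK => ?_⟩, hax, hxb⟩
  rcases le_total z x with h | h
  · exact absurd (hmax ⟨hzK, ha.1.trans hz.1.le, h⟩) (not_le.2 hz.1)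
  · exact absurd (hmin ⟨hzK, h, hz.2.le.trans hb.2⟩) (not_le.2 hz.2)

/-- A function on `K` together with matching functions on the gaps that oscillate little on short
gaps patch to a continuous function. -/
lemma exists_continuous_patch {K : Set ℝ} (hK : IsCompact K) {c d : ℝ} (hc : c ∈ K) (hd : d ∈ K)
    (hKcd : K ⊆ Icc c d) {u : ℝ → ℝ} (hu : ContinuousOn u K) {w : ℝ → ℝ → ℝ → ℝ}
    (hw : ∀ a b, IsGap K a b → Continuous (w a b) ∧ w a b a = u a ∧ w a b b = u b)
    (hosc : ∀ η : ℝ, 0 < η → ∃ δ : ℝ, 0 < δ ∧ ∀ a b, IsGap K a b → b - a < δ →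
      ∀ x ∈ Icc a b, |w a b x - u a| ≤ η) :
    ∃ φ : ℝ → ℝ, Continuous φ ∧ (∀ x ∈ K, φ x = u x) ∧
      ∀ a b, IsGap K a b → ∀ x ∈ Icc a b, φ x = w a b x := by
  classical
  choose! A B hAB hmem using fun x (h : x ∈ Icc c d ∧ x ∉ K) =>
    exists_gap_of_notMem hK hc hd h.1 h.2
  set φ : ℝ → ℝ := fun x => if x ∈ K then u x else w (A x) (B x) x with hφ
  have φK : ∀ x ∈ K, φ x = u x := fun x hx => if_pos hx
  have gsub : ∀ {a b x}, IsGap K a b → x ∈ Icc a b → x ∈ Icc c d := fun h hx =>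
    ⟨(hKcd h.1).1.trans hx.1, hx.2.trans (hKcd h.2.1).2⟩
  have φgap : ∀ a b, IsGap K a b → ∀ x ∈ Icc a b, φ x = w a b x := by
    intro a b h x hx
    rcases hx.1.eq_or_lt with rfl | h1
    · rw [φK _ h.1, (hw _ _ h).2.1]
    rcases hx.2.eq_or_lt with rfl | h2
    · rw [φK _ h.2.1, (hw _ _ h).2.2]
    have hxK := h.2.2.2 x ⟨h1, h2⟩
    have hxx : x ∈ Icc c d ∧ x ∉ K := ⟨gsub h hx, hxK⟩
    obtain ⟨e1, e2⟩ := (hAB x hxx).eq_of_mem h (hmem x hxx) ⟨h1, h2⟩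
    simp only [hφ, if_neg hxK, e1, e2]
  -- Near `x` only points of `K` and short gaps are controlled here. A longer gap can matter only if
  -- it ends at `x`, and there the continuity of `w` suffices.
  have near : ∀ x ∈ K, ∀ ε : ℝ, 0 < ε → ∃ δ : ℝ, 0 < δ ∧ (∀ z ∈ K, |z - x| < δ → |φ z - φ x| < ε) ∧
      ∀ a b, IsGap K a b → b - a < δ → ∀ z ∈ Icc a b, |z - x| < δ → |φ z - φ x| < ε := by
    intro x hx ε hε
    obtain ⟨δ₁, hδ₁, h₁⟩ := Metric.continuousOn_iff.1 hu x hx (ε / 2) (half_pos hε)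
    obtain ⟨δ₂, hδ₂, h₂⟩ := hosc (ε / 2) (half_pos hε)
    simp only [Real.dist_eq] at h₁
    refine ⟨min (δ₁ / 2) δ₂, by positivity, fun z hz hzx => ?_, fun a b hg hab z hz hzx => ?_⟩
    · have := h₁ z hz (by linarith [min_le_left (δ₁ / 2) δ₂])
      rw [φK z hz, φK x hx]; linarith
    · have h3 := h₂ a b hg (hab.trans_le (min_le_right _ _)) z hz
      have h4 := h₁ a hg.1 (by
        have := min_le_left (δ₁ / 2) δ₂
        rw [abs_lt] at hzx ⊢
        constructor <;> linarith [hz.1, hz.2])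
      rw [φgap a b hg z hz, φK x hx]
      have := abs_add_le (w a b z - u a) (u a - u x)
      rw [sub_add_sub_cancel] at this
      linarith
  have right : ∀ x ∈ K, ∀ ε : ℝ, 0 < ε → ∃ ρ : ℝ, 0 < ρ ∧ ∀ z ∈ Icc c d, x ≤ z → z < x + ρ →
      |φ z - φ x| < ε := by
    intro x hx ε hε
    rcases (hKcd hx).2.eq_or_lt with rfl | hxd
    · refine ⟨1, one_pos, fun z hz hxz _ => ?_⟩
      rw [le_antisymm hz.2 hxz]; simpa
    obtain ⟨δ, hδ, n1, n2⟩ := near x hx ε hε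
    rcases exists_near_or_gap_right hK hx hd hxd hδ with ⟨y, hyK, hxy, hyδ, -⟩ | ⟨b, -, hb⟩
    · refine ⟨y - x, sub_pos.2 hxy, fun z hz hxz hzy => ?_⟩
      have hzx : |z - x| < δ := by rw [abs_of_nonneg (by linarith)]; linarith
      by_cases hzK : z ∈ K
      · exact n1 z hzK hzx
      obtain ⟨a, b, hg, haz⟩ := exists_gap_of_notMem hK hc hd hz hzK
      have hax : x ≤ a := by
        by_contra! h
        exact hg.2.2.2 x ⟨h, hxz.trans_lt haz.2⟩ hx
      have hby : b ≤ y := by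
        by_contra! h
        exact hg.2.2.2 y ⟨by linarith [haz.1], h⟩ hyK
      exact n2 a b hg (by linarith) z (Ioo_subset_Icc_self haz) hzx
    · obtain ⟨ρ, hρ, h⟩ := Metric.continuous_iff.1 (hw x b hb).1 x ε hε
      refine ⟨min ρ (b - x), lt_min hρ (sub_pos.2 hb.2.2.1), fun z _ hxz hzρ => ?_⟩
      have m1 := min_le_left ρ (b - x)
      have m2 := min_le_right ρ (b - x)
      rw [φgap x b hb z ⟨hxz, by linarith⟩, φgap x b hb x ⟨le_rfl, hb.2.2.1.le⟩]
      exact h z (by rw [Real.dist_eq, abs_of_nonneg (by linarith)]; linarith)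
  have left : ∀ x ∈ K, ∀ ε : ℝ, 0 < ε → ∃ ρ : ℝ, 0 < ρ ∧ ∀ z ∈ Icc c d, z ≤ x → x - ρ < z →
      |φ z - φ x| < ε := by
    intro x hx ε hε
    rcases (hKcd hx).1.eq_or_lt with rfl | hxc
    · refine ⟨1, one_pos, fun z hz hxz _ => ?_⟩
      rw [le_antisymm hxz hz.1]; simpa
    obtain ⟨δ, hδ, n1, n2⟩ := near x hx ε hε
    rcases exists_near_or_gap_left hK hx hc hxc hδ with ⟨y, hyK, hxy, hyδ, -⟩ | ⟨a, -, ha⟩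
    · refine ⟨x - y, sub_pos.2 hxy, fun z hz hxz hzy => ?_⟩
      have hzx : |z - x| < δ := by rw [abs_sub_comm, abs_of_nonneg (by linarith)]; linarith
      by_cases hzK : z ∈ K
      · exact n1 z hzK hzx
      obtain ⟨a, b, hg, haz⟩ := exists_gap_of_notMem hK hc hd hz hzK
      have hbx : b ≤ x := by
        by_contra! h
        exact hg.2.2.2 x ⟨haz.1.trans_le hxz, h⟩ hx
      have hay : y ≤ a := by
        by_contra! h
        exact hg.2.2.2 y ⟨h, by linarith [haz.2]⟩ hyK
      exact n2 a b hg (by linarith) z (Ioo_subset_Icc_self haz) hzx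
    · obtain ⟨ρ, hρ, h⟩ := Metric.continuous_iff.1 (hw a x ha).1 x ε hε
      refine ⟨min ρ (x - a), lt_min hρ (sub_pos.2 ha.2.2.1), fun z _ hxz hzρ => ?_⟩
      have m1 := min_le_left ρ (x - a)
      have m2 := min_le_right ρ (x - a)
      rw [φgap a x ha z ⟨by linarith, hxz⟩, φgap a x ha x ⟨ha.2.2.1.le, le_rfl⟩]
      exact h z (by rw [Real.dist_eq, abs_sub_comm, abs_of_nonneg (by linarith)]; linarith)
  have cont : ContinuousOn φ (Icc c d) := by
    intro x hx
    by_cases hxK : x ∈ K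
    · rw [Metric.continuousWithinAt_iff]
      intro ε hε
      obtain ⟨ρ₁, hρ₁, r⟩ := right x hxK ε hε
      obtain ⟨ρ₂, hρ₂, l⟩ := left x hxK ε hε
      refine ⟨min ρ₁ ρ₂, lt_min hρ₁ hρ₂, fun z hz hzx => ?_⟩
      rw [Real.dist_eq, abs_lt] at hzx
      have m1 := min_le_left ρ₁ ρ₂
      have m2 := min_le_right ρ₁ ρ₂
      rcases le_total x z with h | h
      · exact r z hz h (by linarith)
      · exact l z hz h (by linarith)
    · obtain ⟨a, b, hg, hxab⟩ := exists_gap_of_notMem hK hc hd hx hxK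
      refine ((hw a b hg).1.continuousAt.congr ?_).continuousWithinAt
      filter_upwards [Ioo_mem_nhds hxab.1 hxab.2] with z hz
      exact (φgap a b hg z (Ioo_subset_Icc_self hz)).symm
  have hcd : c ≤ d := (hKcd hc).2
  -- Outside `[c, d]` the values of `φ` are arbitrary, so it is extended by constants.
  refine ⟨IccExtend hcd (fun x => φ x), (continuousOn_iff_continuous_domRestrict.1 cont).Icc_extend',
    fun x hx => ?_, fun a b hg x hx => ?_⟩
  · rw [IccExtend_of_mem hcd _ (hKcd hx)]; exact φK x hx
  · rw [IccExtend_of_mem hcd _ (gsub hg hx)]; exact φgap a b hg x hx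

/-- A Whitney field on `K` and polynomials interpolating it across the gaps glue to a `C^m`
function. -/
lemma exists_contDiff_glue {m : ℕ} {K : Set ℝ} (hK : IsCompact K) {c d : ℝ} (hc : c ∈ K)
    (hd : d ∈ K) (hKcd : K ⊆ Icc c d) {F : ℕ → ℝ → ℝ} (hJ : IsJet m K F)
    (hF : IsWhitneyField m K F) {Φ : ℝ → ℝ → ℝ[X]}
    (hΦ : ∀ a b, IsGap K a b → ∀ k ≤ m, (derivative^[k] (Φ a b)).eval a = F k a ∧
      (derivative^[k] (Φ a b)).eval b = F k b)
    (hosc : ∀ η : ℝ, 0 < η → ∃ δ : ℝ, 0 < δ ∧ ∀ a b, IsGap K a b → b - a < δ →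
      ∀ x ∈ Icc a b, |(derivative^[m] (Φ a b)).eval x - F m a| ≤ η) :
    ∃ f : ℝ → ℝ, ContDiff ℝ m f ∧ ∀ k ≤ m, (∀ x ∈ K, iteratedDeriv k f x = F k x) ∧
      ∀ a b, IsGap K a b → ∀ x ∈ Icc a b,
        iteratedDeriv k f x = (derivative^[k] (Φ a b)).eval x := by
  obtain ⟨φ, hφ, φK, φgap⟩ := exists_continuous_patch hK hc hd hKcd (hJ m le_rfl)
    (w := fun a b x => (derivative^[m] (Φ a b)).eval x)
    (fun a b hg => ⟨(derivative^[m] (Φ a b)).continuous, hΦ a b hg m le_rfl⟩) hosc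
  obtain ⟨f, hf, hfm, hfc⟩ := exists_iterated_antiderivative m hφ c fun k => F k c
  refine ⟨f, hf, ?_⟩
  -- Downward induction on the order of the derivative. On a gap, `f^(k)` and `Φ^(k)` differ by a
  -- constant, so `f^(k) - F^k` agrees at its two ends; its derivative along `K` is zero and it
  -- vanishes at `c`, hence on `K`.
  have main : ∀ j ≤ m, (∀ x ∈ K, iteratedDeriv (m - j) f x = F (m - j) x) ∧
      ∀ a b, IsGap K a b → ∀ x ∈ Icc a b,
        iteratedDeriv (m - j) f x = (derivative^[m - j] (Φ a b)).eval x := by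
    intro j
    induction j with
    | zero =>
      intro _
      rw [Nat.sub_zero, hfm]
      exact ⟨φK, φgap⟩
    | succ j ih =>
      intro hj
      obtain ⟨ihK, ihgap⟩ := ih (by omega)
      obtain ⟨k, hk⟩ : ∃ k, k = m - (j + 1) := ⟨_, rfl⟩
      have hk1 : m - j = k + 1 := by omega
      have hkm : k < m := by omega
      rw [hk1] at ihK ihgap
      rw [← hk]
      have hconst : ∀ a b, IsGap K a b → ∀ x ∈ Icc a b,
          iteratedDeriv k f x - (derivative^[k] (Φ a b)).eval x
            = iteratedDeriv k f a - (derivative^[k] (Φ a b)).eval a := by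
        intro a b hg x hx
        have := (convex_Icc a b).norm_image_sub_le_of_norm_hasDerivWithin_le (C := 0)
          (f := fun x => iteratedDeriv k f x - (derivative^[k] (Φ a b)).eval x)
          (fun y _ => ((hasDerivAt_iteratedDeriv hf hkm y).sub
            (hasDerivAt_iterate_derivative (Φ a b) k y)).hasDerivWithinAt)
          (fun y hy => by rw [ihgap a b hg y hy, sub_self, norm_zero])
          (left_mem_Icc.2 hg.2.2.1.le) hx
        rw [zero_mul, norm_le_zero_iff] at this
        exact sub_eq_zero.1 this
      have hKk : ∀ x ∈ K, iteratedDeriv k f x = F k x := by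
        intro x hx
        have := eq_of_hasDerivWithinAt_zero hK (D := fun x => iteratedDeriv k f x - F k x)
          (fun y hy => by
            have := (hasDerivAt_iteratedDeriv hf hkm y).hasDerivWithinAt.sub
              (hF.hasDerivWithinAt hkm hy)
            rwa [ihK y hy, sub_self] at this)
          (fun a b hg => by
            have h1 := hconst a b hg b (right_mem_Icc.2 hg.2.2.1.le)
            rw [(hΦ a b hg k hkm.le).1, (hΦ a b hg k hkm.le).2] at h1
            exact h1) hc hx (hKcd hx).1
        simp only [hfc k hkm, sub_self] at this
        exact sub_eq_zero.1 this
      refine ⟨hKk, fun a b hg x hx => ?_⟩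
      have := hconst a b hg x hx
      rw [hKk a hg.1, (hΦ a b hg k hkm.le).1, sub_self] at this
      exact sub_eq_zero.1 this
  intro k hk
  have := main (m - k) (by omega)
  rwa [Nat.sub_sub_self hk] at this

/-! ### Sufficiency: lifting the glued plane curve -/

lemma contDiff_lift {m : ℕ} (hm : 1 ≤ m) {f g h : ℝ → ℝ} (hf : ContDiff ℝ m f)
    (hg : ContDiff ℝ m g)
    (hh : ∀ t, HasDerivAt h (2 * (deriv f t * g t - deriv g t * f t)) t) : ContDiff ℝ m h := by
  obtain ⟨n, rfl⟩ : ∃ n, m = n + 1 := ⟨m - 1, by omega⟩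
  rw [Nat.cast_succ] at *
  have hd : deriv h = fun t => 2 * (deriv f t * g t - deriv g t * f t) :=
    funext fun t => (hh t).deriv
  have cf := (contDiff_succ_iff_deriv.1 hf).2.2
  have cg := (contDiff_succ_iff_deriv.1 hg).2.2
  have cf0 : ContDiff ℝ n f := hf.of_le (by exact_mod_cast n.le_succ)
  have cg0 : ContDiff ℝ n g := hg.of_le (by exact_mod_cast n.le_succ)
  rw [contDiff_succ_iff_deriv, hd]
  exact ⟨fun t => (hh t).differentiableAt, by simp,
    contDiff_const.mul ((cf.mul cg0).sub (cg.mul cf0))⟩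

lemma sufficiency {m : ℕ} (hm : 1 ≤ m) {K : Set ℝ} (hK : IsCompact K) (hne : K.Nonempty)
    {F G H : ℕ → ℝ → ℝ} (jF : IsJet m K F) (jG : IsJet m K G)
    (hF : IsWhitneyField m K F) (hG : IsWhitneyField m K G) (hH : IsWhitneyField m K H)
    (hP : ∀ k : ℕ, 1 ≤ k → k ≤ m → ∀ t ∈ K,
      H k t = MvPolynomial.eval (Sum.elim (fun j => F j t) (fun j => G j t)) (horizPoly k))
    (hA : ∀ ε : ℝ, 0 < ε → ∃ δ : ℝ, 0 < δ ∧ ∀ a ∈ K, ∀ b ∈ K, a < b → b - a < δ →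
      |areaDiscrepancy m F G H a b / velocity m F G a b| < ε) :
    ∃ f g h : ℝ → ℝ, ExtendsTo m K F G H f g h := by
  obtain ⟨c, hc, hcl⟩ := hK.exists_isLeast hne
  obtain ⟨d, hd, hdg⟩ := hK.exists_isGreatest hne
  have hKcd : K ⊆ Icc c d := fun x hx => ⟨hcl hx, hdg hx⟩
  obtain ⟨Φ, Ψ, r, hfill, hr⟩ := exists_gapFill_family hm hF hG hA
  obtain ⟨f, hf, hfJ⟩ := exists_contDiff_glue hK hc hd hKcd jF hF (Φ := Φ)
    (fun a b hg => (hfill a b hg.2.2.1).1) (fun η hη => by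
      obtain ⟨δ, hδ, h⟩ := hr η hη
      exact ⟨δ, hδ, fun a b hg hab x hx => ((hfill a b hg.2.2.1).2.2.2 x hx).1.trans
        (h a hg.1 b hg.2.1 hg.2.2.1 hab)⟩)
  obtain ⟨g, hg, hgJ⟩ := exists_contDiff_glue hK hc hd hKcd jG hG (Φ := Ψ)
    (fun a b hg => (hfill a b hg.2.2.1).2.1) (fun η hη => by
      obtain ⟨δ, hδ, h⟩ := hr η hη
      exact ⟨δ, hδ, fun a b hg hab x hx => ((hfill a b hg.2.2.1).2.2.2 x hx).2.trans
        (h a hg.1 b hg.2.1 hg.2.2.1 hab)⟩)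
  have hm' : (1 : WithTop ℕ∞) ≤ m := by exact_mod_cast hm
  have cf := (hf.of_le hm').continuous_deriv le_rfl
  have cg := (hg.of_le hm').continuous_deriv le_rfl
  have df := hf.continuous
  have dg := hg.continuous
  have cw : Continuous fun t => 2 * (deriv f t * g t - deriv g t * f t) := by fun_prop
  set h : ℝ → ℝ := fun x => H 0 c + ∫ t in c..x, 2 * (deriv f t * g t - deriv g t * f t) with hh
  have hder : ∀ t, HasDerivAt h (2 * (deriv f t * g t - deriv g t * f t)) t := fun t =>
    (cw.integral_hasStrictDerivAt c t).hasDerivAt.const_add (H 0 c)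
  have hor : ∀ t, deriv h t = 2 * (deriv f t * g t - deriv g t * f t) := fun t => (hder t).deriv
  have ch : ContDiff ℝ m h := contDiff_lift hm hf hg hder
  have fK : ∀ k ≤ m, ∀ x ∈ K, iteratedDeriv k f x = F k x := fun k hk => (hfJ k hk).1
  have gK : ∀ k ≤ m, ∀ x ∈ K, iteratedDeriv k g x = G k x := fun k hk => (hgJ k hk).1
  have hH1 : ∀ t ∈ K, H 1 t = 2 * (deriv f t * g t - deriv g t * f t) := by
    intro t ht
    rw [hP 1 le_rfl hm t ht, eval_horizPoly]
    simp [← fK 1 hm t ht, ← gK 1 hm t ht, ← fK 0 (Nat.zero_le _) t ht,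
      ← gK 0 (Nat.zero_le _) t ht]
  -- Condition 2 with `k = 1` makes the derivative of `h - H` along `K` zero, and the prescribed
  -- areas make `h - H` agree at the ends of each gap.
  have h0 : ∀ x ∈ K, h x = H 0 x := by
    intro x hx
    have := eq_of_hasDerivWithinAt_zero hK (D := fun x => h x - H 0 x)
      (fun y hy => by
        have := (hder y).hasDerivWithinAt.sub (hH.hasDerivWithinAt (by omega : 0 < m) hy)
        rwa [zero_add, hH1 y hy, sub_self] at this)
      (fun a b hab => by
        have e1 : h b - h a = ∫ t in a..b, 2 * (deriv f t * g t - deriv g t * f t) :=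
          (intervalIntegral.integral_eq_sub_of_hasDerivAt (fun t _ => hder t)
            (cw.intervalIntegrable _ _)).symm
        have e2 : ∫ t in a..b, 2 * (deriv f t * g t - deriv g t * f t) = H 0 b - H 0 a := by
          rw [← (hfill a b hab.2.2.1).2.2.1, ← intervalIntegral.integral_const_mul]
          refine intervalIntegral.integral_congr fun t ht => ?_
          rw [uIcc_of_le hab.2.2.1.le] at ht
          have a0 := (hfJ 0 (Nat.zero_le _)).2 a b hab t ht
          have a1 := (hfJ 1 hm).2 a b hab t ht
          have b0 := (hgJ 0 (Nat.zero_le _)).2 a b hab t ht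
          have b1 := (hgJ 1 hm).2 a b hab t ht
          simp only [iteratedDeriv_zero, iteratedDeriv_one, Function.iterate_zero_apply,
            Function.iterate_one] at a0 a1 b0 b1
          simp only [a0, a1, b0, b1]
        linarith) hc hx (hKcd hx).1
    have hhc : h c = H 0 c := by simp [hh]
    simp only [hhc, sub_self] at this
    exact sub_eq_zero.1 this
  refine ⟨f, g, h, contDiff_triple_iff.2 ⟨hf, hg, ch⟩,
    (isHorizontalCurve_iff (hf.of_le hm') (hg.of_le hm') (ch.of_le hm')).2 hor,
    fun k hk x hx => ⟨fK k hk x hx, gK k hk x hx, ?_⟩⟩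
  rcases Nat.eq_zero_or_pos k with rfl | hk0
  · rw [iteratedDeriv_zero, h0 x hx]
  · rw [hP k hk0 hk x hx, iteratedDeriv_of_horizontal hf hg hor hk0 hk]
    exact eval_horizPoly_congr hk (fun j hj => fK j hj x hx) fun j hj => gK j hj x hx

lemma extendsTo_empty (m : ℕ) (F G H : ℕ → ℝ → ℝ) :
    ExtendsTo m ∅ F G H (fun _ => 0) (fun _ => 0) (fun _ => 0) :=
  ⟨contDiff_const, (isHorizontalCurve_iff contDiff_const contDiff_const contDiff_const).2
    (by simp), by simp⟩

end HeisWhitney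

theorem theorem1p1 (m : ℕ) (hm : 1 ≤ m) (K : Set ℝ) (hK : IsCompact K)
    (F G H : ℕ → ℝ → ℝ)
    (hF : HeisWhitney.IsJet m K F) (hG : HeisWhitney.IsJet m K G)
    (hH : HeisWhitney.IsJet m K H) :
    (∃ f g h : ℝ → ℝ, HeisWhitney.ExtendsTo m K F G H f g h) ↔
      (HeisWhitney.IsWhitneyField m K F ∧ HeisWhitney.IsWhitneyField m K G ∧
        HeisWhitney.IsWhitneyField m K H) ∧
      (∀ k : ℕ, 1 ≤ k → k ≤ m → ∀ t ∈ K,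
        H k t = MvPolynomial.eval (Sum.elim (fun j => F j t) (fun j => G j t))
          (HeisWhitney.horizPoly k)) ∧
      (∀ ε : ℝ, 0 < ε → ∃ δ : ℝ, 0 < δ ∧ ∀ a ∈ K, ∀ b ∈ K, a < b → b - a < δ →
        |HeisWhitney.areaDiscrepancy m F G H a b / HeisWhitney.velocity m F G a b| < ε) := by
  constructor
  · rintro ⟨f, g, h, hE⟩
    exact HeisWhitney.necessity hm hK hE
  · rintro ⟨⟨wF, wG, wH⟩, hP, hA⟩
    rcases K.eq_empty_or_nonempty with rfl | hne
    · exact ⟨_, _, _, HeisWhitney.extendsTo_empty m F G H⟩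
    · exact HeisWhitney.sufficiency hm hK hne hF hG wF wG wH hP hA
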